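/- Let $1\le k\le n$ and $d\ge k$ be integers. Let $G$ be a simple undirected graph on $n$ vertices with symmetric nonnegative weight matrix $W$ (zero diagonal) and diagonal degree matrix $D$, and let $L$ be either its combinatorial Laplacian $D-W$ or its normalized Laplacian $I-D^{-1/2}WD^{-1/2}$ (with the convention $0^{-1/2}=0$ at isolated vertices). Let $L=U\Lambda U^\top$ be an eigendecomposition with $U\in\mathbb R^{n\times n}$ orthogonal and the diagonal entries of $\Lambda$ sorted in non-decreasing order. Let $\Phi=U_k\in\mathbb R^{n\times k}$ consist of the first $k$ columns of $U$, let $H=U\begin{pmatrix}I_k&0\\0&0\end{pmatrix}U^\top$, let $R\in\mathbb R^{n\times d}$ be a random matrix with independent $N(0,1/d)$ entries, and put $\Psi=HR$. Let $I_{k\times d}$ be the $k\times d$ matrix with ones on its diagonal and zeros elsewhere. Then there is a (random) real $d\times d$ unitary, i.e. orthogonal, matrix $Q=Q(R)$, a measurable function of $R$ which does not depend on $t$, such that for every $t\ge 0$, $$\mathbb P\Big(\|\Psi-\Phi\, I_{k\times d}\,Q\|_F\le\sqrt{\tfrac kd}\,\big(\sqrt k+t\big)\Big)\ \ge\ 1-\exp(-t^2/2).$$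 -/

import Mathlib

open MeasureTheory ProbabilityTheory
open scoped NNReal Matrix

attribute [local instance] Matrix.frobeniusNormedAddCommGroup

noncomputable section

namespace CSC

/-- A simple undirected weighted graph on the vertices `0, …, n - 1`, given by its weight matrix:
`W i j > 0` if `{i, j}` is an edge and `W i j = 0` otherwise. -/
structure WeightedGraph (n : ℕ) where
  W : Matrix (Fin n) (Fin n) ℝ
  symm : ∀ i j, W i j = W j i
  nonneg : ∀ i j, 0 ≤ W i j
  loopless : ∀ i, W i i = 0

namespace WeightedGraph

variable {n : ℕ} (G : WeightedGraph n)

/-- The weighted degree of a vertex. -/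
def degree (i : Fin n) : ℝ := ∑ j, G.W i j

/-- The combinatorial Laplacian `D - W`. -/
def combLaplacian : Matrix (Fin n) (Fin n) ℝ :=
  Matrix.diagonal G.degree - G.W

/-- The normalized Laplacian `I - D^(-1/2) W D^(-1/2)` (with `0^(-1/2) = 0` at isolated
vertices). -/
def normLaplacian : Matrix (Fin n) (Fin n) ℝ :=
  1 - Matrix.diagonal (fun i => (√(G.degree i))⁻¹) * G.W
    * Matrix.diagonal (fun i => (√(G.degree i))⁻¹)

/-- `L` is one of the two Laplacians of the graph. -/
def IsLaplacian (L : Matrix (Fin n) (Fin n) ℝ) : Prop :=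
  L = G.combLaplacian ∨ L = G.normLaplacian

end WeightedGraph

/-- `L = U Λ Uᵀ` with `U` real orthogonal and `Λ = diag(lam)`, the eigenvalues being sorted in
non-decreasing order. -/
structure IsEigendecomposition {n : ℕ} (L U : Matrix (Fin n) (Fin n) ℝ) (lam : Fin n → ℝ) :
    Prop where
  orthogonal : U ∈ Matrix.orthogonalGroup (Fin n) ℝ
  sorted : Monotone lam
  eq : L = U * Matrix.diagonal lam * Uᵀ

/-- The `l × m` matrix with ones on its diagonal and zeros elsewhere. -/
def resize (l m : ℕ) : Matrix (Fin l) (Fin m) ℝ :=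
  Matrix.of fun i j => if i.val = j.val then 1 else 0

/-- The spectral features `Φ`: the first `k` columns of `U`. -/
def spectralFeatures {n k : ℕ} (hkn : k ≤ n) (U : Matrix (Fin n) (Fin n) ℝ) :
    Matrix (Fin n) (Fin k) ℝ :=
  U.submatrix id (Fin.castLE hkn)

/-- The ideal low-pass filter `H = U diag(1, …, 1, 0, …, 0) Uᵀ`, with `k` ones. -/
def lowPass {n : ℕ} (k : ℕ) (U : Matrix (Fin n) (Fin n) ℝ) : Matrix (Fin n) (Fin n) ℝ :=
  U * Matrix.diagonal (fun i : Fin n => if i.val < k then (1 : ℝ) else 0) * Uᵀ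

/-- The compressive features `Ψ = H R` obtained by filtering the columns of `R`. -/
def compressiveFeatures {n d : ℕ} (k : ℕ) (U : Matrix (Fin n) (Fin n) ℝ)
    (R : Matrix (Fin n) (Fin d) ℝ) : Matrix (Fin n) (Fin d) ℝ :=
  lowPass k U * R

/-- `R` is an `n × d` random matrix with independent entries of law `N(0, 1/d)`. -/
structure IsGaussianMatrix {Ω : Type*} [MeasurableSpace Ω] {n d : ℕ}
    (R : Ω → Matrix (Fin n) (Fin d) ℝ) (P : Measure Ω) : Prop where
  law : ∀ i j, HasLaw (fun ω => R ω i j) (gaussianReal 0 ((d : ℝ≥0)⁻¹)) P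
  indep : iIndepFun (fun (p : Fin n × Fin d) (ω : Ω) => R ω p.1 p.2) P

end CSC

end

/-! Since `Q` may be chosen freely, what matters is f, the Frobenius distance from `H R` to the set
of all `Φ I q` with `q` orthogonal. Left multiplication by `H` is a contraction, so f is
(1/√d)-Lipschitz in the standard Gaussian vector √d R. Gaussian concentration
(`stdGaussian_real_ge_le_of_lipschitzWith`) controls its excess over the mean by √(k/d) t, and it
remains to prove E f < k/√d (`integral_procrustesDist_lt`).

Because `H = Φ Φᵀ` and `Φ` has orthonormal columns, only the first k rows of `Uᵀ R` count, and after
scaling by √d they are independent standard Gaussian vectors of ℝ^d. Orthonormalizing them by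
Gram-Schmidt gives an admissible `q`. The inner product of scaled row i (counted from 0) with row i
of `q` is the norm of the i-th Gram-Schmidt vector. This vector is a fresh Gaussian vector projected
onto a subspace of dimension at least d - i, so its mean norm exceeds (d - i - 1/2)/√d
(`lt_integral_norm_gramSchmidt`). The mean squared distance in row i is therefore below 2 - 2(d - i
- 1/2)/d = (2i + 1)/d. These bounds sum to k²/d, and Jensen's inequality gives E f < k/√d.

The strictness of this bound matters: the gap k/√d - E f does not involve t and pays for replacing
the infimum by a measurable, nearly optimal rotation (`exists_measurable_procrustes`). -/

namespace CSC

/-! ### Standard Gaussian measures: linear images, integrability, second moments. -/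

section Gaussian

variable {E F G : Type*} [NormedAddCommGroup E] [InnerProductSpace ℝ E] [FiniteDimensional ℝ E]
  [MeasurableSpace E] [BorelSpace E] [NormedAddCommGroup F] [InnerProductSpace ℝ F]
  [FiniteDimensional ℝ F] [MeasurableSpace F] [BorelSpace F] [NormedAddCommGroup G]
  [InnerProductSpace ℝ G] [FiniteDimensional ℝ G] [MeasurableSpace G] [BorelSpace G]

/-- The image of independent standard Gaussian vectors under a linear co-isometry is a standard
Gaussian vector. -/
theorem stdGaussian_prod_map (A : E →L[ℝ] G) (B : F →L[ℝ] G)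
    (h : ∀ t : G, ‖A.adjoint t‖ ^ 2 + ‖B.adjoint t‖ ^ 2 = ‖t‖ ^ 2) :
    ((stdGaussian E).prod (stdGaussian F)).map (fun p => A p.1 + B p.2) = stdGaussian G := by
  apply Measure.ext_of_charFun
  ext t
  have hm : Measurable (fun p : E × F => A p.1 + B p.2) := by fun_prop
  rw [charFun_apply, integral_map hm.aemeasurable (by fun_prop), charFun_stdGaussian]
  have : ∀ p : E × F, Complex.exp ((inner ℝ (A p.1 + B p.2) t : ℝ) * Complex.I)
      = Complex.exp ((inner ℝ p.1 (A.adjoint t) : ℝ) * Complex.I)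
        * Complex.exp ((inner ℝ p.2 (B.adjoint t) : ℝ) * Complex.I) := by
    intro p
    rw [← Complex.exp_add, inner_add_left, ContinuousLinearMap.adjoint_inner_right,
      ContinuousLinearMap.adjoint_inner_right]
    push_cast
    ring_nf
  simp_rw [this]
  rw [integral_prod_mul (f := fun x : E => Complex.exp ((inner ℝ x (A.adjoint t) : ℝ) * Complex.I))
    (g := fun y : F => Complex.exp ((inner ℝ y (B.adjoint t) : ℝ) * Complex.I)),
    ← charFun_apply, ← charFun_apply, charFun_stdGaussian, charFun_stdGaussian, ← Complex.exp_add]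
  congr 1
  rw [show (‖t‖ : ℂ) ^ 2 = ((‖t‖ ^ 2 : ℝ) : ℂ) by push_cast; rfl, ← h t]
  push_cast
  ring

theorem stdGaussian_map_of_adjoint (A : E →L[ℝ] G) (h : ∀ t : G, ‖A.adjoint t‖ = ‖t‖) :
    (stdGaussian E).map A = stdGaussian G := by
  apply Measure.ext_of_charFun
  ext t
  rw [charFun_apply, integral_map (by fun_prop) (by fun_prop), charFun_stdGaussian, ← h t,
    ← charFun_stdGaussian, charFun_apply]
  simp_rw [ContinuousLinearMap.adjoint_inner_right]

/-- Fernique's theorem, with c‖x‖ ≤ c²/(4C) + C‖x‖² obtained by completing the square. -/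
theorem integrable_exp_mul_norm_stdGaussian (c : ℝ) :
    Integrable (fun x : E => Real.exp (c * ‖x‖)) (stdGaussian E) := by
  obtain ⟨C, hC, hI⟩ := IsGaussian.exists_integrable_exp_sq (stdGaussian E)
  refine (hI.const_mul (Real.exp (c ^ 2 / (4 * C)))).mono' (by fun_prop) (ae_of_all _ fun x => ?_)
  rw [Real.norm_of_nonneg (Real.exp_pos _).le, ← Real.exp_add]
  refine Real.exp_le_exp.2 ?_
  have : c ^ 2 / (4 * C) + C * ‖x‖ ^ 2 - c * ‖x‖ = C * (‖x‖ - c / (2 * C)) ^ 2 := by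
    field_simp
    ring
  have := mul_nonneg hC.le (sq_nonneg (‖x‖ - c / (2 * C)))
  linarith

theorem integrable_norm_pow_stdGaussian (p : ℕ) :
    Integrable (fun x : E => ‖x‖ ^ p) (stdGaussian E) := by
  simpa using (IsGaussian.memLp_id (stdGaussian E) p (by simp)).integrable_norm_pow'

theorem integrable_of_lipschitzWith_stdGaussian {K : ℝ≥0} {f : E → ℝ} (hf : LipschitzWith K f) :
    Integrable f (stdGaussian E) := by
  refine ((((integrable_norm_pow_stdGaussian (E := E) 1).const_mul (K : ℝ)).add
    (integrable_const |f 0|))).mono' hf.continuous.aestronglyMeasurable (ae_of_all _ fun x => ?_)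
  have := hf.dist_le_mul x 0
  rw [Real.dist_eq, dist_zero_right] at this
  have h2 := abs_sub_abs_le_abs_sub (f x) (f 0)
  simp only [Pi.add_apply, pow_one, Real.norm_eq_abs]
  linarith

theorem integrable_exp_mul_of_lipschitzWith_stdGaussian {K : ℝ≥0} {f : E → ℝ}
    (hf : LipschitzWith K f) (c : ℝ) :
    Integrable (fun x => Real.exp (c * f x)) (stdGaussian E) := by
  refine ((integrable_exp_mul_norm_stdGaussian (E := E) (|c| * K)).const_mul
    (Real.exp (|c| * |f 0|))).mono'
    (by have := hf.continuous; fun_prop) (ae_of_all _ fun x => ?_)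
  have := hf.dist_le_mul x 0
  rw [Real.dist_eq, dist_zero_right] at this
  have h2 := abs_sub_abs_le_abs_sub (f x) (f 0)
  rw [Real.norm_of_nonneg (Real.exp_pos _).le, ← Real.exp_add]
  refine Real.exp_le_exp.2 ((le_abs_self _).trans ?_)
  rw [abs_mul]
  nlinarith [abs_nonneg c]

theorem integral_inner_sq_stdGaussian (L : StrongDual ℝ E) :
    ∫ x, L x ^ 2 ∂stdGaussian E = ‖L‖ ^ 2 := by
  rw [← variance_dual_stdGaussian, variance_eq_integral (by fun_prop)]
  simp

theorem integral_norm_sq_stdGaussian :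
    ∫ x : E, ‖x‖ ^ 2 ∂stdGaussian E = Module.finrank ℝ E := by
  have : ∀ x : E, ‖x‖ ^ 2 = ∑ i, (innerSL ℝ (stdOrthonormalBasis ℝ E i) x) ^ 2 := fun x => by
    rw [← (stdOrthonormalBasis ℝ E).sum_sq_inner_right x]
    rfl
  simp_rw [this]
  rw [integral_finsetSum _ fun i _ => ?_]
  · simp_rw [integral_inner_sq_stdGaussian, innerSL_apply_norm]
    simp
  · refine (integrable_norm_pow_stdGaussian (E := E) 2).mono' (by fun_prop)
      (ae_of_all _ fun x => ?_)
    rw [norm_pow]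
    gcongr
    simpa using norm_inner_le_norm (𝕜 := ℝ) (stdOrthonormalBasis ℝ E i) x

end Gaussian

/-! ### Gaussian concentration for Lipschitz functions, by splitting the Gaussian into many small
independent increments. -/

section Concentration

theorem abs_sub_le_of_lipschitzWith_one {E : Type*} [SeminormedAddCommGroup E] {g : E → ℝ} (hg : LipschitzWith 1 g) (x w : E) :
    |g (x + w) - g x| ≤ ‖w‖ := by
  simpa [Real.dist_eq] using hg.dist_le_mul (x + w) x

theorem lipschitzWith_comp_add_smul {E : Type*} [SeminormedAddCommGroup E]
    [NormedSpace ℝ E] {K : ℝ≥0} {g : E → ℝ} (hg : LipschitzWith K g) (x : E)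
    (h : ℝ) : LipschitzWith (K * ‖h‖₊) (fun z => g (x + h • z)) := by
  refine hg.comp (LipschitzWith.of_dist_le_mul fun y z => ?_)
  simp [dist_eq_norm, ← smul_sub, norm_smul]

variable {E : Type*} [NormedAddCommGroup E] [InnerProductSpace ℝ E]

/-- `g` is differentiable with derivative bounded by `1` and `C`-Lipschitz. -/
def IsSmoothContraction (C : ℝ≥0) (g : E → ℝ) : Prop :=
  ∃ g' : E → E →L[ℝ] ℝ, (∀ x, HasFDerivAt g (g' x) x) ∧ (∀ x, ‖g' x‖ ≤ 1) ∧ LipschitzWith C g'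

theorem IsSmoothContraction.lipschitzWith {C : ℝ≥0} {g : E → ℝ} (hg : IsSmoothContraction C g) :
    LipschitzWith 1 g := by
  obtain ⟨g', h1, h2, -⟩ := hg
  refine lipschitzWith_of_nnnorm_fderiv_le (fun x => (h1 x).differentiableAt) fun x => ?_
  rw [(h1 x).fderiv]
  exact h2 x

theorem abs_sub_sub_le_of_lipschitzWith_fderiv {C : ℝ≥0} {g : E → ℝ} {g' : E → E →L[ℝ] ℝ}
    (h : ∀ x, HasFDerivAt g (g' x) x) (hg' : LipschitzWith C g') (x w : E) :
    |g (x + w) - g x - g' x w| ≤ C * ‖w‖ ^ 2 := by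
  have := (convex_closedBall x ‖w‖).norm_image_sub_le_of_norm_hasFDerivWithin_le' (f := g)
    (f' := g') (φ := g' x) (C := C * ‖w‖) (x := x) (y := x + w)
    (fun y _ => (h y).hasFDerivWithinAt)
    (fun y hy => (by
      have h1 := hg'.dist_le_mul y x
      rw [dist_eq_norm] at h1
      exact h1.trans (by gcongr; exact hy)))
    (by simp) (by simp)
  simpa [pow_two, mul_assoc] using this

variable [FiniteDimensional ℝ E] [MeasurableSpace E] [BorelSpace E]

/-- The average of `g` at Gaussian scale `h`. -/
noncomputable def gaussAverage (h : ℝ) (g : E → ℝ) (x : E) : ℝ :=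
  ∫ z, g (x + h • z) ∂stdGaussian E

/-- Averaging keeps the same `C`, so the one-step estimate can be iterated without loss. -/
theorem IsSmoothContraction.gaussAverage {C : ℝ≥0} {g : E → ℝ} (hg : IsSmoothContraction C g)
    (h : ℝ) : IsSmoothContraction C (gaussAverage h g) := by
  have hL := hg.lipschitzWith
  obtain ⟨g', h1, h2, h3⟩ := hg
  have hc : ∀ x : E, Continuous fun z : E => g' (x + h • z) := fun x => by
    have := h3.continuous
    fun_prop
  have hi : ∀ x : E, Integrable (fun z : E => g' (x + h • z)) (stdGaussian E) := fun x =>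
    (integrable_const (1 : ℝ)).mono' (hc x).aestronglyMeasurable (ae_of_all _ fun z => h2 _)
  refine ⟨fun x => ∫ z, g' (x + h • z) ∂stdGaussian E, fun x => ?_, fun x => ?_, ?_⟩
  · refine hasFDerivAt_integral_of_dominated_of_fderiv_le (s := Set.univ) (bound := fun _ => 1)
      (F := fun x z => g (x + h • z)) (F' := fun x z => g' (x + h • z)) Filter.univ_mem
      (Filter.Eventually.of_forall fun y => ?_) ?_ (hc x).aestronglyMeasurable
      (ae_of_all _ fun z y _ => h2 _) (integrable_const _) (ae_of_all _ fun z y _ => ?_)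
    · have := hL.continuous
      fun_prop
    · exact integrable_of_lipschitzWith_stdGaussian (lipschitzWith_comp_add_smul hL x h)
    · exact (hasFDerivAt_comp_add_right (h • z)).2 (h1 (y + h • z))
  · refine (norm_integral_le_of_norm_le_const (ae_of_all _ fun z => h2 _)).trans ?_
    simp
  · refine LipschitzWith.of_dist_le_mul fun x y => ?_
    rw [dist_eq_norm, ← integral_sub (hi x) (hi y)]
    refine (norm_integral_le_of_norm_le_const (C := C * dist x y) (ae_of_all _ fun z => ?_)).trans
      (by simp)
    rw [← dist_eq_norm]
    simpa using h3.dist_le_mul (x + h • z) (y + h • z)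

theorem exp_le_one_add_add_sq_add (y : ℝ) :
    Real.exp y ≤ 1 + y + y ^ 2 / 2 + |y| ^ 3 * Real.exp |y| := by
  have := Complex.norm_exp_sub_sum_le_norm_mul_exp (y : ℂ) 3
  simp only [Finset.sum_range_succ, Finset.sum_range_zero, Nat.factorial] at this
  norm_cast at this
  simp only [Real.norm_eq_abs] at this
  have := (abs_le.1 this).2
  norm_num at this
  linarith

/-- One small step: at scale h the variance of `g` is at most h² + O(h³), since ‖g'‖ ≤ 1. The point
is that `K` is uniform in `g`, `h` and `x`. -/
theorem integral_exp_gaussAverage_le (C : ℝ≥0) {l : ℝ} (hl : 0 ≤ l) :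
    ∃ K : ℝ, ∀ (g : E → ℝ), IsSmoothContraction C g → ∀ h : ℝ, 0 ≤ h → h ≤ 1 → ∀ x : E,
      ∫ z, Real.exp (l * g (x + h • z)) ∂stdGaussian E
        ≤ Real.exp (l * gaussAverage h g x + (l ^ 2 * h ^ 2 / 2 + K * h ^ 3)) := by
  set γ := stdGaussian E
  set M : ℕ → ℝ := fun p => ∫ z : E, ‖z‖ ^ p ∂γ with hM
  have hI : ∀ p, Integrable (fun z : E => ‖z‖ ^ p) γ := integrable_norm_pow_stdGaussian
  have hM0 : ∀ p, 0 ≤ M p := fun p => integral_nonneg fun z => by positivity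
  -- This is 6 exp(2s) with s = l(‖z‖ + M 1). It dominates the cubic remainder s³ exp(s), as s³ ≤ 3!
  -- exp(s).
  set B : E → ℝ := fun z => 6 * Real.exp (2 * l * M 1) * Real.exp (2 * l * ‖z‖) with hB
  have hBI : Integrable B γ := (integrable_exp_mul_norm_stdGaussian _).const_mul _
  refine ⟨l ^ 2 / 2 * (2 * C * M 3 + C ^ 2 * M 4) + ∫ z, B z ∂γ, fun g hg h h0 h1 x => ?_⟩
  have hL := hg.lipschitzWith
  obtain ⟨g', hd, hb, hLip⟩ := hg
  set m := gaussAverage h g x with hm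
  set D : E → ℝ := fun z => g (x + h • z) - g x with hD
  have hgI : Integrable (fun z => g (x + h • z)) γ :=
    integrable_of_lipschitzWith_stdGaussian (lipschitzWith_comp_add_smul hL x h)
  have hDI : Integrable D γ := hgI.sub (integrable_const _)
  have hDc : Continuous D := by
    have := hL.continuous
    fun_prop
  have hDle : ∀ z, |D z| ≤ h * ‖z‖ := fun z => by
    have := abs_sub_le_of_lipschitzWith_one hL x (h • z)
    rwa [norm_smul, Real.norm_of_nonneg h0] at this
  set e := ∫ z, D z ∂γ with he
  have hme : m = g x + e := by
    rw [he, integral_sub hgI (integrable_const _)]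
    simp [hm, gaussAverage, γ]
  have hele : |e| ≤ h * M 1 := by
    refine (abs_integral_le_integral_abs).trans ?_
    rw [hM, ← integral_const_mul]
    exact integral_mono hDI.abs ((hI 1).const_mul _) fun z => by simpa using hDle z
  -- Square the expansion D = h g'(x)z + O(h²‖z‖²); the h⁴ term is absorbed using h ≤ 1.
  have hD2 : ∀ z, D z ^ 2 ≤ h ^ 2 * (g' x z) ^ 2 + h ^ 3 * (2 * C * ‖z‖ ^ 3)
      + h ^ 3 * (C ^ 2 * ‖z‖ ^ 4) := fun z => by
    have h2 := abs_sub_sub_le_of_lipschitzWith_fderiv hd hLip x (h • z)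
    rw [norm_smul, Real.norm_of_nonneg h0, map_smul, smul_eq_mul] at h2
    have h3 : |g' x z| ≤ ‖z‖ := by
      simpa using (g' x).le_of_opNorm_le (hb x) z
    have h4 : |D z| ≤ h * |g' x z| + C * (h * ‖z‖) ^ 2 := by
      have := abs_add_le (D z - h * g' x z) (h * g' x z)
      rw [sub_add_cancel, abs_mul h, abs_of_nonneg h0] at this
      linarith
    have h5 : D z ^ 2 ≤ (h * |g' x z| + C * (h * ‖z‖) ^ 2) ^ 2 := by
      rw [← sq_abs]
      gcongr
    refine h5.trans ?_
    have h6 : |g' x z| * (C * h ^ 3 * ‖z‖ ^ 2) ≤ ‖z‖ * (C * h ^ 3 * ‖z‖ ^ 2) := by gcongr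
    have h7 : h ^ 4 * (C ^ 2 * ‖z‖ ^ 4) ≤ h ^ 3 * (C ^ 2 * ‖z‖ ^ 4) := by
      have : h ^ 4 ≤ h ^ 3 := pow_le_pow_of_le_one h0 h1 (by norm_num)
      gcongr
    have h8 : h ^ 2 * |g' x z| ^ 2 = h ^ 2 * (g' x z) ^ 2 := by rw [sq_abs]
    nlinarith
  have hLI : Integrable (fun z => (g' x z) ^ 2) γ := by
    refine (hI 2).mono' (by fun_prop) (ae_of_all _ fun z => ?_)
    rw [norm_pow]
    gcongr
    simpa using (g' x).le_of_opNorm_le (hb x) z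
  have hDsqI : Integrable (fun z => D z ^ 2) γ := by
    refine ((hI 2).const_mul (h ^ 2)).mono' (by fun_prop) (ae_of_all _ fun z => ?_)
    rw [norm_pow, ← mul_pow]
    gcongr
    exact hDle z
  have hED2 : ∫ z, D z ^ 2 ∂γ ≤ h ^ 2 + h ^ 3 * (2 * C * M 3 + C ^ 2 * M 4) := by
    have i1 := hLI.const_mul (h ^ 2)
    have i2 := ((hI 3).const_mul (2 * (C : ℝ))).const_mul (h ^ 3)
    have i3 := ((hI 4).const_mul ((C : ℝ) ^ 2)).const_mul (h ^ 3)
    refine (integral_mono hDsqI ((i1.add i2).add i3) hD2).trans ?_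
    rw [integral_add' (i1.add i2) i3, integral_add' i1 i2]
    simp_rw [integral_const_mul]
    rw [integral_inner_sq_stdGaussian]
    have : ‖g' x‖ ^ 2 ≤ 1 := pow_le_one₀ (norm_nonneg _) (hb x)
    have := mul_le_mul_of_nonneg_left this (sq_nonneg h)
    simp only [hM]
    linarith
  -- Centering at `e` makes the linear term integrate to zero, and |l(D - e)| ≤ hs extracts the
  -- factor h³ from the remainder.
  have hpt : ∀ z, Real.exp (l * (D z - e)) ≤ 1 + l * (D z - e) + l ^ 2 / 2 * (D z - e) ^ 2
      + h ^ 3 * B z := fun z => by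
    refine (exp_le_one_add_add_sq_add _).trans ?_
    have h2 : |l * (D z - e)| ≤ h * (l * (‖z‖ + M 1)) := by
      rw [abs_mul, abs_of_nonneg hl]
      have := abs_sub (D z) e
      nlinarith [hDle z]
    set s := l * (‖z‖ + M 1) with hs
    have hs0 : 0 ≤ s := mul_nonneg hl (add_nonneg (norm_nonneg _) (hM0 1))
    have h3 : |l * (D z - e)| ^ 3 * Real.exp |l * (D z - e)| ≤ (h * s) ^ 3 * Real.exp s := by
      gcongr
      nlinarith
    have h4 : s ^ 3 ≤ 6 * Real.exp s := by
      have := Real.pow_div_factorial_le_exp s hs0 3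
      norm_num [Nat.factorial] at this
      linarith
    have h5 : B z = 6 * Real.exp s * Real.exp s := by
      simp only [hB, hs, mul_assoc, ← Real.exp_add]
      ring_nf
    have h6 : (h * s) ^ 3 * Real.exp s ≤ h ^ 3 * B z := by
      rw [h5, mul_pow, mul_assoc]
      gcongr
    nlinarith
  have hsqI : Integrable (fun z => (D z - e) ^ 2) γ := by
    have : (fun z => (D z - e) ^ 2) = fun z => D z ^ 2 - 2 * e * D z + e ^ 2 := by
      ext z; ring
    rw [this]
    exact (hDsqI.sub (hDI.const_mul _)).add (integrable_const _)
  have hvar : ∫ z, (D z - e) ^ 2 ∂γ ≤ ∫ z, D z ^ 2 ∂γ := by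
    have : (fun z => (D z - e) ^ 2) = fun z => D z ^ 2 - 2 * e * D z + e ^ 2 := by
      ext z; ring
    have hi : Integrable (fun z => D z ^ 2 - 2 * e * D z) γ := hDsqI.sub (hDI.const_mul _)
    rw [this, integral_add hi (integrable_const _),
      integral_sub hDsqI (hDI.const_mul _), integral_const_mul, ← he]
    simp
    nlinarith [sq_nonneg e]
  have hexpI : Integrable (fun z => Real.exp (l * (D z - e))) γ := by
    have : (fun z => Real.exp (l * (D z - e)))
        = fun z => Real.exp (-(l * m)) * Real.exp (l * g (x + h • z)) := by
      ext z
      rw [← Real.exp_add, hme]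
      simp only [hD]
      ring_nf
    rw [this]
    exact (integrable_exp_mul_of_lipschitzWith_stdGaussian
      (lipschitzWith_comp_add_smul hL x h) l).const_mul _
  have hcent : ∫ z, (D z - e) ∂γ = 0 := by
    rw [integral_sub hDI (integrable_const _)]
    simp [he]
  have hcI : Integrable (fun z => D z - e) γ := hDI.sub (integrable_const _)
  have hmain : ∫ z, Real.exp (l * (D z - e)) ∂γ ≤ 1 + l ^ 2 / 2 * ∫ z, D z ^ 2 ∂γ
      + h ^ 3 * ∫ z, B z ∂γ := by
    have i1 := (integrable_const (1 : ℝ)).add (hcI.const_mul l) (μ := γ)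
    have i2 := hsqI.const_mul (l ^ 2 / 2)
    have i3 := hBI.const_mul (h ^ 3)
    refine (integral_mono hexpI ((i1.add i2).add i3) hpt).trans ?_
    rw [integral_add' (i1.add i2) i3, integral_add' i1 i2,
      integral_add' (integrable_const _) (hcI.const_mul l)]
    simp_rw [integral_const_mul]
    rw [hcent]
    have := mul_le_mul_of_nonneg_left hvar (by positivity : 0 ≤ l ^ 2 / 2)
    simp
    linarith
  have hfin : ∫ z, Real.exp (l * (D z - e)) ∂γ ≤ Real.exp (l ^ 2 * h ^ 2 / 2
      + (l ^ 2 / 2 * (2 * C * M 3 + C ^ 2 * M 4) + ∫ z, B z ∂γ) * h ^ 3) := by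
    refine le_trans ?_ (Real.add_one_le_exp _)
    refine hmain.trans ?_
    have := mul_le_mul_of_nonneg_left hED2 (by positivity : 0 ≤ l ^ 2 / 2)
    linarith
  rw [Real.exp_add]
  have : ∀ z, Real.exp (l * g (x + h • z)) = Real.exp (l * m) * Real.exp (l * (D z - e)) := by
    intro z
    rw [← Real.exp_add, hme]
    simp only [hD]
    ring_nf
  simp_rw [this]
  rw [integral_const_mul]
  gcongr

/-- Semigroup property: independent Gaussians of scales a and b add up to one of scale c.
Integrability of the inner integral is kept for later comparison of integrals. -/
theorem integral_stdGaussian_add_smul {f : E → ℝ} (hf : Continuous f) {a b c : ℝ}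
    (hc : 0 < c) (h : a ^ 2 + b ^ 2 = c ^ 2) (x : E)
    (hfi : Integrable (fun z => f (x + c • z)) (stdGaussian E)) :
    ∫ z, f (x + c • z) ∂stdGaussian E
      = ∫ z, ∫ w, f (x + a • z + b • w) ∂stdGaussian E ∂stdGaussian E ∧
    Integrable (fun z => ∫ w, f (x + a • z + b • w) ∂stdGaussian E) (stdGaussian E) := by
  have key := stdGaussian_prod_map ((a / c) • ContinuousLinearMap.id ℝ E)
    ((b / c) • ContinuousLinearMap.id ℝ E) (fun t => by
      simp only [map_smulₛₗ, ContinuousLinearMap.adjoint_id, smul_apply,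
        norm_smul, ContinuousLinearMap.id_apply, mul_pow, Real.norm_eq_abs, sq_abs]
      simp only [conj_trivial, div_pow]
      rw [← add_mul, ← add_div, h, div_self (by positivity), one_mul])
  have hm : Measurable (fun p : E × E => ((a / c) • ContinuousLinearMap.id ℝ E) p.1
    + ((b / c) • ContinuousLinearMap.id ℝ E) p.2) := by fun_prop
  have heq : ∀ p : E × E, f (x + c • (((a / c) • ContinuousLinearMap.id ℝ E) p.1
      + ((b / c) • ContinuousLinearMap.id ℝ E) p.2)) = f (x + a • p.1 + b • p.2) := by
    intro p
    simp only [smul_apply, ContinuousLinearMap.id_apply, smul_add, smul_smul,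
      mul_div_cancel₀ _ hc.ne', add_assoc]
  rw [← key] at hfi
  have h2 := (integrable_map_measure (by fun_prop) hm.aemeasurable).1 hfi
  have h3 : Integrable (fun p : E × E => f (x + a • p.1 + b • p.2))
      ((stdGaussian E).prod (stdGaussian E)) := h2.congr (ae_of_all _ heq)
  refine ⟨?_, h3.integral_prod_left⟩
  conv_lhs => rw [← key]
  rw [integral_map hm.aemeasurable (by fun_prop)]
  simp_rw [heq]
  exact integral_prod _ h3

/-- Peel off one increment of scale h, which turns `g` into its average at the cost of `c`, then
apply the induction hypothesis to that average. -/
theorem integral_exp_sqrt_mul_le {C : ℝ≥0} {l h c : ℝ} (hh : 0 < h)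
    (hstep : ∀ g : E → ℝ, IsSmoothContraction C g → ∀ x : E,
      ∫ z, Real.exp (l * g (x + h • z)) ∂stdGaussian E
        ≤ Real.exp (l * gaussAverage h g x + c)) (N : ℕ) :
    ∀ g : E → ℝ, IsSmoothContraction C g → ∀ x : E,
      ∫ z, Real.exp (l * g (x + (√N * h) • z)) ∂stdGaussian E
        ≤ Real.exp (l * gaussAverage (√N * h) g x + N * c) := by
  induction N with
  | zero => intro g hg x; simp [gaussAverage]
  | succ N ih =>
    intro g hg x
    have hL := hg.lipschitzWith
    have hp : 0 < √((N + 1 : ℕ) : ℝ) * h := by positivity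
    have hsq : (√(N : ℝ) * h) ^ 2 + h ^ 2 = (√((N + 1 : ℕ) : ℝ) * h) ^ 2 := by
      rw [mul_pow, mul_pow, Real.sq_sqrt (by positivity), Real.sq_sqrt (by positivity)]
      push_cast
      ring
    have hcont : Continuous fun y => Real.exp (l * g y) := by
      have := hL.continuous
      fun_prop
    obtain ⟨e1, i1⟩ := integral_stdGaussian_add_smul hcont hp hsq x
      (integrable_exp_mul_of_lipschitzWith_stdGaussian (lipschitzWith_comp_add_smul hL x _) l)
    obtain ⟨e2, -⟩ := integral_stdGaussian_add_smul hL.continuous hp hsq x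
      (integrable_of_lipschitzWith_stdGaussian (lipschitzWith_comp_add_smul hL x _))
    have ha := hg.gaussAverage h
    rw [e1]
    calc _ ≤ ∫ z, Real.exp c * Real.exp (l * gaussAverage h g (x + (√N * h) • z))
          ∂stdGaussian E := by
          refine integral_mono i1 ((integrable_exp_mul_of_lipschitzWith_stdGaussian
            (lipschitzWith_comp_add_smul ha.lipschitzWith x _) l).const_mul _) fun z => ?_
          rw [← Real.exp_add, add_comm c]
          exact hstep g hg _
      _ ≤ Real.exp c * Real.exp (l * gaussAverage (√N * h) (gaussAverage h g) x + N * c) := by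
          rw [integral_const_mul]
          gcongr
          exact ih _ ha x
      _ = _ := by
          rw [← Real.exp_add]
          have : gaussAverage (√((N + 1 : ℕ) : ℝ) * h) g x
              = gaussAverage (√N * h) (gaussAverage h g) x := e2
          rw [this]
          push_cast
          ring_nf

theorem IsSmoothContraction.integral_exp_le {C : ℝ≥0} {g : E → ℝ} (hg : IsSmoothContraction C g)
    {l : ℝ} (hl : 0 ≤ l) :
    ∫ z, Real.exp (l * g z) ∂stdGaussian E
      ≤ Real.exp (l * ∫ z, g z ∂stdGaussian E + l ^ 2 / 2) := by
  obtain ⟨K, hK⟩ := integral_exp_gaussAverage_le (E := E) C hl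
  have hlim : Filter.Tendsto (fun N : ℕ => Real.exp (l * ∫ z, g z ∂stdGaussian E
      + (l ^ 2 / 2 + K * (√((N + 1 : ℕ) : ℝ))⁻¹))) Filter.atTop
      (nhds (Real.exp (l * ∫ z, g z ∂stdGaussian E + (l ^ 2 / 2 + K * 0)))) := by
    have h1 : Filter.Tendsto (fun N : ℕ => (√((N + 1 : ℕ) : ℝ))⁻¹) Filter.atTop (nhds 0) :=
      (Real.tendsto_sqrt_atTop.comp
        (tendsto_natCast_atTop_atTop.comp (Filter.tendsto_add_atTop_nat 1))).inv_tendsto_atTop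
    exact (Real.continuous_exp.tendsto _).comp
      (((h1.const_mul K).const_add _).const_add _)
  rw [mul_zero, add_zero] at hlim
  refine ge_of_tendsto' hlim fun N => ?_
  have hs : 1 ≤ √((N + 1 : ℕ) : ℝ) := by
    rw [Real.one_le_sqrt]
    push_cast
    linarith [(Nat.cast_nonneg N : (0 : ℝ) ≤ N)]
  have hs0 : 0 < √((N + 1 : ℕ) : ℝ) := by linarith
  have hsq : √((N + 1 : ℕ) : ℝ) ^ 2 = ((N + 1 : ℕ) : ℝ) := Real.sq_sqrt (by positivity)
  -- With N + 1 steps of scale h = 1/√(N + 1), the total scale is 1 and the total error (N + 1)Kh³ =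
  -- K/√(N + 1) vanishes in the limit.
  have := integral_exp_sqrt_mul_le (inv_pos.2 hs0)
    (fun g hg x => hK g hg _ (inv_pos.2 hs0).le (inv_le_one_of_one_le₀ hs) x) (N + 1) g hg 0
  rw [mul_inv_cancel₀ hs0.ne'] at this
  simp only [one_smul, zero_add, CSC.gaussAverage] at this
  refine this.trans (le_of_eq ?_)
  congr 2
  generalize √((N + 1 : ℕ) : ℝ) = s at hsq hs0
  rw [← hsq]
  field_simp

-- Mollification by a bump supported at distance ε: convolving with a probability density preserves
-- the Lipschitz constant 1, and the derivative falls on the bump.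
open scoped Convolution in
theorem exists_isSmoothContraction_abs_sub_le {f : E → ℝ} (hf : LipschitzWith 1 f) {ε : ℝ}
    (hε : 0 < ε) :
    ∃ C : ℝ≥0, ∃ g : E → ℝ, IsSmoothContraction C g ∧ ∀ x, |g x - f x| ≤ ε := by
  let φ : ContDiffBump (0 : E) := ⟨ε / 2, ε, by positivity, by linarith⟩
  let L := ContinuousLinearMap.lsmul ℝ ℝ (E := ℝ)
  set u : E → ℝ := φ.normed volume with hu
  have hu1 : ContDiff ℝ 1 u := φ.contDiff_normed
  have hus : HasCompactSupport u := φ.hasCompactSupport_normed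
  have hfl : LocallyIntegrable f volume := hf.continuous.locallyIntegrable
  have hd : ∀ x, HasFDerivAt (u ⋆[L, volume] f)
      ((fderiv ℝ u ⋆[L.precompL E, volume] f) x) x := fun x =>
    hus.hasFDerivAt_convolution_left L hu1 hfl x
  have huI : Integrable u volume := hu1.continuous.integrable_of_hasCompactSupport hus
  have hdI : Integrable (fun t => ‖fderiv ℝ u t‖) volume :=
    ((hu1.continuous_fderiv one_ne_zero).integrable_of_hasCompactSupport (hus.fderiv ℝ)).norm
  have hLip : ∀ x y t : E, |f (x - t) - f (y - t)| ≤ ‖x - y‖ := fun x y t => by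
    simpa [Real.dist_eq, dist_eq_norm] using hf.dist_le_mul (x - t) (y - t)
  have hce : ∀ x, Integrable (fun t => L (u t) (f (x - t))) volume := fun x =>
    hus.convolutionExists_left L hu1.continuous hfl x
  have hce' : ∀ x, Integrable (fun t => (L.precompL E) (fderiv ℝ u t) (f (x - t))) volume :=
    fun x => (hus.fderiv ℝ).convolutionExists_left (L.precompL E)
      (hu1.continuous_fderiv one_ne_zero) hfl x
  have hLip1 : LipschitzWith 1 (u ⋆[L, volume] f) := by
    refine LipschitzWith.of_dist_le_mul fun x y => ?_
    rw [dist_eq_norm, convolution, convolution, ← integral_sub (hce x) (hce y)]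
    refine (norm_integral_le_of_norm_le (huI.mul_const ‖x - y‖) (ae_of_all _ fun t => ?_)).trans ?_
    · have h0 : 0 ≤ u t := φ.nonneg_normed t
      simp only [L, ContinuousLinearMap.lsmul_apply, smul_eq_mul, ← mul_sub, norm_mul,
        Real.norm_eq_abs, abs_of_nonneg h0]
      exact mul_le_mul_of_nonneg_left (hLip x y t) h0
    · rw [integral_mul_const, φ.integral_normed]
      simp [dist_eq_norm]
  -- The derivative is the convolution of Du with `f`, hence Lipschitz with constant ∫‖Du‖. Its
  -- bound by 1 comes instead from `hLip1`.
  refine ⟨(∫ t, ‖fderiv ℝ u t‖).toNNReal, u ⋆[L, volume] f, ⟨_, hd, fun x => ?_, ?_⟩, fun x => ?_⟩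
  · simpa using (hd x).le_of_lipschitz hLip1
  · refine LipschitzWith.of_dist_le_mul fun x y => ?_
    rw [dist_eq_norm, convolution, convolution, ← integral_sub (hce' x) (hce' y)]
    refine (norm_integral_le_of_norm_le (hdI.mul_const ‖x - y‖) (ae_of_all _ fun t => ?_)).trans ?_
    · rw [← map_sub]
      refine ContinuousLinearMap.opNorm_le_bound _ (by positivity) fun v => ?_
      have h1 := (fderiv ℝ u t).le_opNorm v
      have h2 := hLip x y t
      rw [← Real.norm_eq_abs] at h2
      simp only [L, ContinuousLinearMap.precompL_apply, ContinuousLinearMap.lsmul_apply,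
        smul_eq_mul, norm_mul]
      calc _ ≤ ‖fderiv ℝ u t‖ * ‖v‖ * ‖x - y‖ := by gcongr
        _ = _ := by ring
    · rw [integral_mul_const, Real.coe_toNNReal _ (integral_nonneg fun t => norm_nonneg _),
        dist_eq_norm]
  · rw [← Real.dist_eq]
    refine φ.dist_normed_convolution_le hf.continuous.aestronglyMeasurable fun y hy => ?_
    refine (hf.dist_le_mul y x).trans ?_
    simpa using (Metric.mem_ball.1 hy).le

/-- Lipschitz functions of a standard Gaussian vector are subgaussian. -/
theorem integral_exp_le_of_lipschitzWith_one {f : E → ℝ} (hf : LipschitzWith 1 f) {l : ℝ}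
    (hl : 0 ≤ l) :
    ∫ z, Real.exp (l * f z) ∂stdGaussian E
      ≤ Real.exp (l * ∫ z, f z ∂stdGaussian E + l ^ 2 / 2) := by
  have hlim : Filter.Tendsto (fun ε : ℝ => Real.exp (l * (∫ z, f z ∂stdGaussian E + 2 * ε)
      + l ^ 2 / 2)) (nhdsWithin 0 (Set.Ioi 0))
      (nhds (Real.exp (l * (∫ z, f z ∂stdGaussian E + 2 * 0) + l ^ 2 / 2))) := by
    refine Filter.Tendsto.mono_left ?_ nhdsWithin_le_nhds
    exact Continuous.tendsto (by fun_prop) 0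
  rw [mul_zero, add_zero] at hlim
  refine ge_of_tendsto hlim (Filter.eventually_of_mem self_mem_nhdsWithin fun ε hε => ?_)
  obtain ⟨C, g, hg, hgf⟩ := exists_isSmoothContraction_abs_sub_le hf hε
  have hgI := integrable_of_lipschitzWith_stdGaussian hg.lipschitzWith
  have hfI := integrable_of_lipschitzWith_stdGaussian hf
  have h1 : ∫ z, Real.exp (l * f z) ∂stdGaussian E
      ≤ Real.exp (l * ε) * ∫ z, Real.exp (l * g z) ∂stdGaussian E := by
    rw [← integral_const_mul]
    refine integral_mono (integrable_exp_mul_of_lipschitzWith_stdGaussian hf l)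
      ((integrable_exp_mul_of_lipschitzWith_stdGaussian hg.lipschitzWith l).const_mul _)
      fun z => ?_
    rw [← Real.exp_add, ← mul_add]
    refine Real.exp_le_exp.2 (mul_le_mul_of_nonneg_left ?_ hl)
    linarith [(abs_le.1 (hgf z)).1]
  have h2 : ∫ z, g z ∂stdGaussian E ≤ ∫ z, f z ∂stdGaussian E + ε := by
    have : ∫ z, f z + ε ∂stdGaussian E = ∫ z, f z ∂stdGaussian E + ε := by
      rw [integral_add hfI (integrable_const _)]
      simp
    rw [← this]
    exact integral_mono hgI (hfI.add (integrable_const _)) fun z => by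
      have := (abs_le.1 (hgf z)).2
      linarith
  refine h1.trans ((mul_le_mul_of_nonneg_left (hg.integral_exp_le hl)
    (Real.exp_pos _).le).trans ?_)
  rw [← Real.exp_add]
  refine Real.exp_le_exp.2 ?_
  have := mul_le_mul_of_nonneg_left h2 hl
  linarith

/-- The Gaussian concentration inequality for Lipschitz functions, with the sharp constant. -/
theorem stdGaussian_real_ge_le_of_lipschitzWith {K : ℝ≥0} (hK : 0 < K) {f : E → ℝ}
    (hf : LipschitzWith K f) {s : ℝ} (hs : 0 ≤ s) :
    (stdGaussian E).real {z | ∫ y, f y ∂stdGaussian E + K * s ≤ f z} ≤ Real.exp (-s ^ 2 / 2) := by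
  have hK' : (0 : ℝ) < K := hK
  set g : E → ℝ := fun z => (K : ℝ)⁻¹ * f z with hg
  have hgL : LipschitzWith 1 g := by
    refine LipschitzWith.of_dist_le_mul fun x y => ?_
    have := hf.dist_le_mul x y
    simp only [hg, Real.dist_eq, ← mul_sub, abs_mul, abs_inv, NNReal.abs_eq] at this ⊢
    rw [inv_mul_le_iff₀ hK']
    simpa using this
  have hset : {z | ∫ y, f y ∂stdGaussian E + K * s ≤ f z}
      = {z | ∫ y, g y ∂stdGaussian E + s ≤ g z} := by
    ext z
    simp only [hg, Set.mem_ofPred_eq, integral_const_mul]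
    conv_rhs => rw [← mul_le_mul_iff_right₀ hK', mul_add, mul_inv_cancel_left₀ hK'.ne',
      mul_inv_cancel_left₀ hK'.ne']
  rw [hset]
  -- Chernoff bound at the optimal parameter, equal to the deviation s itself.
  refine (ProbabilityTheory.measure_ge_le_exp_mul_mgf (X := g) _ hs
    (integrable_exp_mul_of_lipschitzWith_stdGaussian hgL s)).trans ?_
  rw [mgf]
  refine (mul_le_mul_of_nonneg_left (integral_exp_le_of_lipschitzWith_one hgL hs)
    (Real.exp_pos _).le).trans ?_
  rw [← Real.exp_add]
  refine Real.exp_le_exp.2 (le_of_eq ?_)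
  ring

end Concentration

/-! ### Lower bounds for the mean norm of a Gaussian vector. -/

section Chi

variable {E : Type*} [NormedAddCommGroup E] [InnerProductSpace ℝ E] [FiniteDimensional ℝ E]
  [MeasurableSpace E] [BorelSpace E]

/-- The density makes polar coordinates available; the two measures are compared through their
characteristic functions. -/
theorem stdGaussian_eq_withDensity :
    stdGaussian E = volume.withDensity (fun x : E => ENNReal.ofReal
      (((2 * Real.pi) ^ (Module.finrank ℝ E / 2 : ℝ))⁻¹ * Real.exp (-‖x‖ ^ 2 / 2))) := by
  set Z : ℝ := (2 * Real.pi) ^ (Module.finrank ℝ E / 2 : ℝ) with hZ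
  have hZ0 : 0 < Z := Real.rpow_pos_of_pos (by positivity) _
  set ρ : E → ℝ := fun x => Z⁻¹ * Real.exp (-‖x‖ ^ 2 / 2) with hρ
  have hρ0 : ∀ x, 0 ≤ ρ x := fun x => by positivity
  have hI : Integrable ρ volume := by
    have h := (GaussianFourier.integrable_cexp_neg_mul_sq_norm_add (V := E) (b := 1 / 2)
      (by norm_num) 0 0).norm.const_mul Z⁻¹
    refine h.congr (ae_of_all _ fun x => ?_)
    have : -(1 / 2 : ℂ) * ‖x‖ ^ 2 + 0 * (inner ℝ (0 : E) x : ℝ) = ((-‖x‖ ^ 2 / 2 : ℝ) : ℂ) := by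
      push_cast
      ring
    simp only [hρ, Complex.norm_exp]
    rw [this, Complex.ofReal_re]
  have hfin : IsFiniteMeasure (volume.withDensity fun x : E => ENNReal.ofReal (ρ x)) :=
    isFiniteMeasure_withDensity_ofReal hI.2
  apply Measure.ext_of_charFun
  ext t
  rw [charFun_stdGaussian, charFun_apply,
    integral_withDensity_eq_integral_toReal_smul (by fun_prop) (by simp)]
  have h1 : ∀ x : E, (ENNReal.ofReal (ρ x)).toReal • Complex.exp ((inner ℝ x t : ℝ) * Complex.I)
      = (Z⁻¹ : ℂ) * Complex.exp (-(1 / 2 : ℂ) * ‖x‖ ^ 2 + Complex.I * (inner ℝ t x : ℝ)) := by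
    intro x
    rw [ENNReal.toReal_ofReal (hρ0 x), Complex.exp_add, real_inner_comm, Complex.real_smul,
      hρ]
    push_cast
    rw [mul_assoc]
    congr 3
    · ring
    · ring
  rw [integral_congr_ae (ae_of_all _ h1), integral_const_mul,
    GaussianFourier.integral_cexp_neg_mul_sq_norm_add (by norm_num)]
  have h2 : ((Real.pi : ℂ) / (1 / 2)) ^ (Module.finrank ℝ E / 2 : ℂ) = (Z : ℂ) := by
    rw [hZ, Complex.ofReal_cpow (by positivity)]
    push_cast
    congr 1
    ring
  rw [h2, ← mul_assoc, inv_mul_cancel₀ (by exact_mod_cast hZ0.ne'), one_mul, Complex.I_sq]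
  congr 1
  ring

theorem integral_pow_mul_exp_neg_sq_div_two (q : ℕ) :
    ∫ y in Set.Ioi (0 : ℝ), y ^ (q + 2) * Real.exp (-y ^ 2 / 2)
      = (q + 1) * ∫ y in Set.Ioi (0 : ℝ), y ^ q * Real.exp (-y ^ 2 / 2) := by
  have key : ∀ p : ℕ, ∫ y in Set.Ioi (0 : ℝ), y ^ p * Real.exp (-y ^ 2 / 2)
      = (1 / 2 : ℝ) ^ (-((p : ℝ) + 1) / 2) * (1 / 2) * Real.Gamma (((p : ℝ) + 1) / 2) := by
    intro p
    rw [← integral_rpow_mul_exp_neg_mul_rpow (p := 2) (q := p) (by norm_num)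
      (by linarith [(Nat.cast_nonneg p : (0 : ℝ) ≤ p)]) (by norm_num)]
    refine setIntegral_congr_fun measurableSet_Ioi fun y _ => ?_
    simp only [Real.rpow_natCast]
    congr 2
    norm_cast
    ring
  rw [key, key]
  have h1 : (((q + 2 : ℕ) : ℝ) + 1) / 2 = ((q : ℝ) + 1) / 2 + 1 := by push_cast; ring
  have h2 : -(((q + 2 : ℕ) : ℝ) + 1) / 2 = -((q : ℝ) + 1) / 2 + (-1) := by push_cast; ring
  rw [h1, h2, Real.Gamma_add_one (by positivity), Real.rpow_add (by norm_num), Real.rpow_neg_one]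
  ring

/-- In polar coordinates both moments carry the same constant, and the radial integrals are related
by the Gamma recursion. -/
theorem integral_norm_cube_stdGaussian (hE : 0 < Module.finrank ℝ E) :
    ∫ x : E, ‖x‖ ^ 3 ∂stdGaussian E
      = (Module.finrank ℝ E + 1) * ∫ x : E, ‖x‖ ∂stdGaussian E := by
  have : Nontrivial E := Module.finrank_pos_iff.1 hE
  set r := Module.finrank ℝ E with hr
  have key : ∀ p : ℕ, ∫ x : E, ‖x‖ ^ p ∂stdGaussian E
      = (r * (volume.real (Metric.ball (0 : E) 1) * ((2 * Real.pi) ^ (r / 2 : ℝ))⁻¹))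
        * ∫ y in Set.Ioi (0 : ℝ), y ^ (r - 1 + p) * Real.exp (-y ^ 2 / 2) := by
    intro p
    rw [stdGaussian_eq_withDensity,
      integral_withDensity_eq_integral_toReal_smul (by fun_prop) (by simp)]
    rw [integral_fun_norm_addHaar volume (fun t => (ENNReal.ofReal
      (((2 * Real.pi) ^ (r / 2 : ℝ))⁻¹ * Real.exp (-t ^ 2 / 2))).toReal • t ^ p)]
    simp only [nsmul_eq_mul, smul_eq_mul, ← hr, mul_assoc]
    congr 2
    rw [← integral_const_mul]
    refine setIntegral_congr_fun measurableSet_Ioi fun y _ => ?_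
    rw [ENNReal.toReal_ofReal (by positivity), pow_add]
    ring
  have h1 := key 1
  simp only [pow_one] at h1
  rw [key 3, h1, show r - 1 + 3 = r + 2 by omega, show r - 1 + 1 = r by omega,
    integral_pow_mul_exp_neg_sq_div_two]
  ring

/-- Take the mean of ‖x‖(‖x‖ - s)² ≥ 0 with s² = r + 1. As E‖x‖³ = s² E‖x‖ and E‖x‖² = r, this reads
2s(s E‖x‖ - r) ≥ 0. -/
theorem le_integral_norm_stdGaussian (hE : 0 < Module.finrank ℝ E) :
    (Module.finrank ℝ E : ℝ) / √(Module.finrank ℝ E + 1) ≤ ∫ x : E, ‖x‖ ∂stdGaussian E := by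
  set r : ℝ := (Module.finrank ℝ E : ℝ) with hr
  set s := √(r + 1) with hs
  have hr0 : 0 ≤ r := Nat.cast_nonneg _
  have hs0 : 0 < s := by positivity
  have hs2 : s ^ 2 = r + 1 := Real.sq_sqrt (by positivity)
  have h3 : Integrable (fun x : E => ‖x‖ ^ 3) (stdGaussian E) := integrable_norm_pow_stdGaussian 3
  have h2 : Integrable (fun x : E => ‖x‖ ^ 2) (stdGaussian E) := integrable_norm_pow_stdGaussian 2
  have h1 : Integrable (fun x : E => ‖x‖) (stdGaussian E) := by
    simpa using integrable_norm_pow_stdGaussian (E := E) 1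
  have h0 : 0 ≤ ∫ x : E, (‖x‖ ^ 3 - 2 * s * ‖x‖ ^ 2 + s ^ 2 * ‖x‖) ∂stdGaussian E := by
    refine integral_nonneg fun x => ?_
    have : ‖x‖ ^ 3 - 2 * s * ‖x‖ ^ 2 + s ^ 2 * ‖x‖ = ‖x‖ * (‖x‖ - s) ^ 2 := by ring
    simp only [this]
    positivity
  have h32 : Integrable (fun x : E => ‖x‖ ^ 3 - 2 * s * ‖x‖ ^ 2) (stdGaussian E) :=
    h3.sub (h2.const_mul _)
  rw [integral_add h32 (h1.const_mul _), integral_sub h3 (h2.const_mul _), integral_const_mul,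
    integral_const_mul, integral_norm_sq_stdGaussian, integral_norm_cube_stdGaussian hE, ← hr,
    ← hs2] at h0
  rw [div_le_iff₀ hs0]
  have : 0 ≤ (2 * s) * ((∫ x : E, ‖x‖ ∂stdGaussian E) * s - r) := by linarith
  linarith [nonneg_of_mul_nonneg_right this (by positivity)]

/-- After reduction to m = r = d the claim is (r - 1/2)²(r + 1) < r³, that is, r > 1/3. -/
theorem sub_half_div_sqrt_lt {m r d : ℕ} (hm : 0 < m) (hmr : m ≤ r) (hrd : r ≤ d) :
    ((m : ℝ) - 1 / 2) / √d < r / √(r + 1) := by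
  have h1 : (1 : ℝ) ≤ r := by exact_mod_cast (by omega : 1 ≤ r)
  have h2 : (m : ℝ) ≤ r := by exact_mod_cast hmr
  have h3 : (r : ℝ) ≤ d := by exact_mod_cast hrd
  have hd : 0 < √(d : ℝ) := Real.sqrt_pos.2 (by linarith)
  rw [div_lt_div_iff₀ hd (by positivity)]
  calc ((m : ℝ) - 1 / 2) * √(r + 1) ≤ (r - 1 / 2) * √(r + 1) := by gcongr
    _ < r * √r := by
      refine lt_of_pow_lt_pow_left₀ 2 (by positivity) ?_
      rw [mul_pow, mul_pow, Real.sq_sqrt (by positivity), Real.sq_sqrt (by positivity)]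
      nlinarith
    _ ≤ r * √d := by gcongr

/-- The mean norm of the projection of a standard Gaussian vector. -/
theorem lt_integral_norm_starProjection_stdGaussian (W : Submodule ℝ E) {m : ℕ} (hm : 0 < m)
    (hW : m ≤ Module.finrank ℝ W) :
    ((m : ℝ) - 1 / 2) / √(Module.finrank ℝ E) < ∫ x, ‖W.starProjection x‖ ∂stdGaussian E := by
  have h := stdGaussian_map_of_adjoint (E := E) W.orthogonalProjectionOnto fun t => by
    rw [Submodule.adjoint_orthogonalProjectionOnto]
    rfl
  have h2 : ∫ x, ‖W.starProjection x‖ ∂stdGaussian E = ∫ y : W, ‖y‖ ∂stdGaussian W := by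
    rw [← h, integral_map (by fun_prop) (by fun_prop)]
    rfl
  rw [h2]
  exact (sub_half_div_sqrt_lt hm hW (Submodule.finrank_le W)).trans_le
    (le_integral_norm_stdGaussian (hm.trans_le hW))

end Chi

/-! ### Gram-Schmidt vectors as projections, and their mean norms. -/

section GramSchmidt

open InnerProductSpace Submodule

variable {F : Type*} [NormedAddCommGroup F] [InnerProductSpace ℝ F] {d : ℕ}

theorem gramSchmidt_mem_orthogonal (f : Fin d → F) (i : Fin d) :
    gramSchmidt ℝ f i ∈ (span ℝ (f '' Set.Iio i))ᗮ := by
  rw [← span_gramSchmidt_Iio ℝ f i, mem_orthogonal]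
  intro u hu
  induction hu using span_induction with
  | mem x hx =>
    obtain ⟨j, hj, rfl⟩ := hx
    exact gramSchmidt_orthogonal ℝ f (ne_of_lt hj)
  | zero => simp
  | add x y _ _ hx hy => rw [inner_add_left, hx, hy, add_zero]
  | smul a x _ hx => rw [inner_smul_left, hx, mul_zero]

theorem sub_gramSchmidt_mem_span (f : Fin d → F) (i : Fin d) :
    f i - gramSchmidt ℝ f i ∈ span ℝ (f '' Set.Iio i) := by
  rw [← span_gramSchmidt_Iio ℝ f i, sub_eq_of_eq_add' (gramSchmidt_def'' ℝ f i)]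
  refine sum_mem fun j hj => smul_mem _ _ (subset_span ⟨j, ?_, rfl⟩)
  simpa using hj

theorem inner_gramSchmidt_self (f : Fin d → F) (i : Fin d) :
    inner ℝ (gramSchmidt ℝ f i) (f i) = ‖gramSchmidt ℝ f i‖ ^ 2 := by
  have h := inner_left_of_mem_orthogonal (sub_gramSchmidt_mem_span f i)
    (gramSchmidt_mem_orthogonal f i)
  rw [inner_sub_right, real_inner_self_eq_norm_sq] at h
  linarith

variable [FiniteDimensional ℝ F]

theorem gramSchmidt_eq_starProjection (f : Fin d → F) (i : Fin d) :
    gramSchmidt ℝ f i = (span ℝ (f '' Set.Iio i))ᗮ.starProjection (f i) := by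
  refine (eq_starProjection_of_mem_orthogonal' (gramSchmidt_mem_orthogonal f i)
    (z := f i - gramSchmidt ℝ f i) ?_ (by abel)).symm
  rw [orthogonal_orthogonal]
  exact sub_gramSchmidt_mem_span f i

/-- This holds without linear independence: if the Gram-Schmidt vector is zero, both sides vanish.
No almost sure rank statement is then needed. -/
theorem inner_gramSchmidtOrthonormalBasis_self (h : Module.finrank ℝ F = Fintype.card (Fin d))
    (f : Fin d → F) (i : Fin d) :
    inner ℝ (f i) (gramSchmidtOrthonormalBasis h f i) = ‖gramSchmidt ℝ f i‖ := by
  by_cases hi : gramSchmidtNormed ℝ f i = 0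
  · rw [real_inner_comm, inner_gramSchmidtOrthonormalBasis_eq_zero h hi]
    simp only [gramSchmidtNormed, smul_eq_zero, inv_eq_zero] at hi
    rcases hi with hi | hi
    · exact (by simpa using hi : ‖gramSchmidt ℝ f i‖ = 0).symm
    · simp [hi]
  · rw [gramSchmidtOrthonormalBasis_apply h hi, gramSchmidtNormed, inner_smul_right,
      real_inner_comm, inner_gramSchmidt_self]
    have : ‖gramSchmidt ℝ f i‖ ≠ 0 := fun h0 => hi (by simp [gramSchmidtNormed, h0])
    simp only [RCLike.ofReal_real_eq_id, id]
    field_simp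

theorem le_finrank_orthogonal_span_image_Iio (hd : Module.finrank ℝ F = d) (f : Fin d → F)
    (i : Fin d) : d - i ≤ Module.finrank ℝ (span ℝ (f '' Set.Iio i))ᗮ := by
  have h1 := finrank_add_finrank_orthogonal (span ℝ (f '' Set.Iio i))
  have h2 : Module.finrank ℝ (span ℝ (f '' Set.Iio i)) ≤ i := by
    classical
    rw [← Finset.coe_Iio, ← Finset.coe_image]
    refine (finrank_span_finset_le_card _).trans (Finset.card_image_le.trans ?_)
    simp
  omega

variable [MeasurableSpace F] [BorelSpace F]

theorem measurable_gramSchmidt (i : Fin d) :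
    Measurable fun f : Fin d → F => gramSchmidt ℝ f i := by
  induction i using WellFoundedLT.induction with
  | _ i ih =>
    have : (fun f : Fin d → F => gramSchmidt ℝ f i) = fun f => f i - ∑ j ∈ Finset.Iio i,
        (inner ℝ (gramSchmidt ℝ f j) (f i) / (‖gramSchmidt ℝ f j‖ : ℝ) ^ 2)
          • gramSchmidt ℝ f j :=
      funext fun f => (sub_eq_of_eq_add (gramSchmidt_def'' ℝ f i)).symm
    rw [this]
    refine (measurable_pi_apply i).sub (Finset.measurable_sum _ fun j hj => ?_)
    have := ih j (by simpa using hj)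
    have hi : Measurable fun f : Fin d → F => f i := measurable_pi_apply i
    exact ((this.inner hi).div (this.norm.pow_const 2)).smul this

variable {E : Type*} [NormedAddCommGroup E] [InnerProductSpace ℝ E] [FiniteDimensional ℝ E]
  [MeasurableSpace E] [BorelSpace E]

/-- The mean of the Gram-Schmidt vectors of independent standard Gaussian vectors. -/
theorem lt_integral_norm_gramSchmidt (hd : Module.finrank ℝ F = d) (a : E → Fin d → F)
    (ha : Measurable a) (i : Fin d) (B : E →L[ℝ] F) (hB : ∀ y, B (B.adjoint y) = y)
    (hai : ∀ g, a g i = B g)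
    (haj : ∀ j < i, ∀ g x, a (g - B.adjoint (B g) + B.adjoint x) j = a g j) :
    Integrable (fun g => ‖gramSchmidt ℝ (a g) i‖) (stdGaussian E) ∧
    (((d - i : ℕ) : ℝ) - 1 / 2) / √d < ∫ g, ‖gramSchmidt ℝ (a g) i‖ ∂stdGaussian E := by
  have hm : Measurable fun g => ‖gramSchmidt ℝ (a g) i‖ := ((measurable_gramSchmidt i).comp ha).norm
  have hI : Integrable (fun g => ‖gramSchmidt ℝ (a g) i‖) (stdGaussian E) := by
    refine ((integrable_norm_pow_stdGaussian (E := E) 1).const_mul ‖B‖).mono'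
      hm.aestronglyMeasurable (ae_of_all _ fun g => ?_)
    rw [norm_norm, gramSchmidt_eq_starProjection, hai, pow_one]
    exact (norm_starProjection_apply_le _ _).trans (B.le_opNorm g)
  refine ⟨hI, ?_⟩
  -- `A` removes the component of `g` seen by `B`. Adding `B.adjoint x` with an independent Gaussian
  -- `x` resamples vector i, preserving the law of `g` and the earlier vectors.
  set A : E →L[ℝ] E := ContinuousLinearMap.id ℝ E - B.adjoint ∘L B with hA
  have hBn : ∀ y, ‖B.adjoint y‖ ^ 2 = ‖y‖ ^ 2 := fun y => by
    rw [← real_inner_self_eq_norm_sq, ContinuousLinearMap.adjoint_inner_left, hB,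
      real_inner_self_eq_norm_sq]
  have hAadj : A.adjoint = A := by
    rw [hA, map_sub, ContinuousLinearMap.adjoint_id, ContinuousLinearMap.adjoint_comp,
      ContinuousLinearMap.adjoint_adjoint]
  have hlaw := stdGaussian_prod_map A B.adjoint fun t => by
    rw [hAadj, ContinuousLinearMap.adjoint_adjoint]
    have : A t = t - B.adjoint (B t) := rfl
    rw [this, norm_sub_sq_real, hBn, ContinuousLinearMap.adjoint_inner_right,
      real_inner_self_eq_norm_sq]
    ring
  have hms : Measurable fun p : E × F => A p.1 + B.adjoint p.2 := by fun_prop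
  have hval : ∀ p : E × F, ‖gramSchmidt ℝ (a (A p.1 + B.adjoint p.2)) i‖
      = ‖(span ℝ (a p.1 '' Set.Iio i))ᗮ.starProjection p.2‖ := by
    intro p
    have h1 : A p.1 + B.adjoint p.2 = p.1 - B.adjoint (B p.1) + B.adjoint p.2 := rfl
    have h2 : a (A p.1 + B.adjoint p.2) i = p.2 := by
      rw [hai, h1, map_add, map_sub, hB, hB, sub_self, zero_add]
    have h3 : a (A p.1 + B.adjoint p.2) '' Set.Iio i = a p.1 '' Set.Iio i :=
      Set.image_congr fun j hj => by rw [h1, haj j hj]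
    rw [gramSchmidt_eq_starProjection, h2, h3]
  have hI' := hI
  rw [← hlaw] at hI'
  have hI2 : Integrable (fun p : E × F => ‖gramSchmidt ℝ (a (A p.1 + B.adjoint p.2)) i‖)
      ((stdGaussian E).prod (stdGaussian F)) :=
    (integrable_map_measure hm.aestronglyMeasurable hms.aemeasurable).1 hI'
  conv_rhs => rw [← hlaw]
  rw [integral_map hms.aemeasurable hm.aestronglyMeasurable, integral_prod _ hI2]
  set c : ℝ := (((d - i : ℕ) : ℝ) - 1 / 2) / √d with hc
  -- Conditionally on the earlier vectors the projection is onto a fixed subspace. The bound is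
  -- strict for every `g`, so it stays strict after integration.
  have hpos : ∀ g, 0 < (∫ x, ‖gramSchmidt ℝ (a (A g + B.adjoint x)) i‖ ∂stdGaussian F) - c := by
    intro g
    rw [sub_pos, integral_congr_ae (ae_of_all _ fun x => hval (g, x))]
    have := lt_integral_norm_starProjection_stdGaussian (span ℝ (a g '' Set.Iio i))ᗮ
      (m := d - i) (by omega) (le_finrank_orthogonal_span_image_Iio hd _ i)
    rwa [hd] at this
  have hint := hI2.integral_prod_left
  have hfin : 0 < ∫ g, ((∫ x, ‖gramSchmidt ℝ (a (A g + B.adjoint x)) i‖ ∂stdGaussian F) - c)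
      ∂stdGaussian E := by
    rw [integral_pos_iff_support_of_nonneg (fun g => (hpos g).le)
      (hint.sub (integrable_const _))]
    have : Function.support (fun g =>
        (∫ x, ‖gramSchmidt ℝ (a (A g + B.adjoint x)) i‖ ∂stdGaussian F) - c) = Set.univ :=
      Set.eq_univ_of_forall fun g => (hpos g).ne'
    rw [this]
    simp
  rw [integral_sub hint (integrable_const _)] at hfin
  simpa using hfin

end GramSchmidt

/-! ### Frobenius norms and the rows of `Uᵀ R`. -/

section Matrices

variable {n k d : ℕ}

theorem frobenius_norm_sq_eq_sum_row {m : Type*} [Fintype m] (X : Matrix m (Fin d) ℝ) :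
    ‖X‖ ^ 2 = ∑ i, ‖(WithLp.toLp 2 (X i) : EuclideanSpace ℝ (Fin d))‖ ^ 2 := by
  rw [Matrix.frobenius_norm_def, ← Real.rpow_natCast, ← Real.rpow_mul (by positivity)]
  norm_num
  exact Finset.sum_congr rfl fun i _ => by rw [EuclideanSpace.real_norm_sq_eq]

theorem frobenius_norm_sq_eq_trace {m : Type*} [Fintype m] (X : Matrix m (Fin d) ℝ) :
    ‖X‖ ^ 2 = (Xᵀ * X).trace := by
  rw [frobenius_norm_sq_eq_sum_row, Matrix.trace]
  simp_rw [EuclideanSpace.real_norm_sq_eq, Matrix.diag, Matrix.mul_apply, Matrix.transpose_apply]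
  rw [Finset.sum_comm]
  simp [pow_two]

theorem frobenius_norm_mul_of_transpose_mul_self {m l : Type*} [Fintype m] [Fintype l]
    [DecidableEq l] {V : Matrix m l ℝ} (hV : Vᵀ * V = 1) (X : Matrix l (Fin d) ℝ) :
    ‖V * X‖ = ‖X‖ := by
  rw [← pow_left_inj₀ (norm_nonneg _) (norm_nonneg _) two_ne_zero, frobenius_norm_sq_eq_trace,
    frobenius_norm_sq_eq_trace, Matrix.transpose_mul, Matrix.mul_assoc, ← Matrix.mul_assoc Vᵀ, hV,
    Matrix.one_mul]

theorem spectralFeatures_transpose_mul_self (hkn : k ≤ n) {U : Matrix (Fin n) (Fin n) ℝ}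
    (hU : Uᵀ * U = 1) : (spectralFeatures hkn U)ᵀ * spectralFeatures hkn U = 1 := by
  ext i j
  have := congrFun (congrFun hU (Fin.castLE hkn i)) (Fin.castLE hkn j)
  simp only [Matrix.one_apply, Fin.castLE_inj] at this
  rw [Matrix.one_apply]
  exact this

theorem lowPass_eq (hkn : k ≤ n) (U : Matrix (Fin n) (Fin n) ℝ) :
    lowPass k U = spectralFeatures hkn U * (spectralFeatures hkn U)ᵀ := by
  ext a b
  rw [lowPass, Matrix.mul_apply, Matrix.mul_apply]
  simp only [spectralFeatures, Matrix.mul_diagonal, Matrix.transpose_apply, Matrix.submatrix_apply,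
    id]
  rw [← Finset.sum_subset (Finset.subset_univ (Finset.univ.map (Fin.castLEEmb hkn)))]
  · rw [Finset.sum_map]
    exact Finset.sum_congr rfl fun i _ => by simp
  · intro i _ hi
    have : ¬ i.val < k := fun h => hi (Finset.mem_map.2 ⟨⟨i, h⟩, Finset.mem_univ _, rfl⟩)
    simp [this]

theorem resize_mul_apply (hkd : k ≤ d) (q : Matrix (Fin d) (Fin d) ℝ) (i : Fin k) :
    (resize k d * q) i = q (Fin.castLE hkd i) := by
  ext c
  rw [Matrix.mul_apply, Finset.sum_eq_single (Fin.castLE hkd i)]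
  · simp [resize]
  · intro j _ hj
    have : i.val ≠ j.val := fun h => hj (Fin.ext h.symm)
    simp [resize, this]
  · simp

theorem norm_spectralFeatures_transpose_mul_le (hkn : k ≤ n) {U : Matrix (Fin n) (Fin n) ℝ}
    (hU : U * Uᵀ = 1) (X : Matrix (Fin n) (Fin d) ℝ) : ‖(spectralFeatures hkn U)ᵀ * X‖ ≤ ‖X‖ := by
  have h : ‖Uᵀ * X‖ = ‖X‖ := frobenius_norm_mul_of_transpose_mul_self (by simpa using hU) X
  rw [← h, ← pow_le_pow_iff_left₀ (norm_nonneg _) (norm_nonneg _) two_ne_zero,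
    frobenius_norm_sq_eq_sum_row, frobenius_norm_sq_eq_sum_row]
  calc _ = ∑ i ∈ Finset.univ.map (Fin.castLEEmb hkn),
        ‖(WithLp.toLp 2 ((Uᵀ * X) i) : EuclideanSpace ℝ (Fin d))‖ ^ 2 := by
        rw [Finset.sum_map]
        rfl
    _ ≤ _ := Finset.sum_le_sum_of_subset_of_nonneg (Finset.subset_univ _)
        fun i _ _ => by positivity

theorem norm_lowPass_mul_le (hkn : k ≤ n) {U : Matrix (Fin n) (Fin n) ℝ}
    (hU : Uᵀ * U = 1) (hU' : U * Uᵀ = 1) (X : Matrix (Fin n) (Fin d) ℝ) :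
    ‖lowPass k U * X‖ ≤ ‖X‖ := by
  rw [lowPass_eq hkn, Matrix.mul_assoc,
    frobenius_norm_mul_of_transpose_mul_self (spectralFeatures_transpose_mul_self hkn hU)]
  exact norm_spectralFeatures_transpose_mul_le hkn hU' X

/-- Factor `Φ` out of the difference: having orthonormal columns, it preserves the Frobenius norm,
and the rows decouple. -/
theorem norm_lowPass_mul_sub_sq (hkn : k ≤ n) (hkd : k ≤ d) {U : Matrix (Fin n) (Fin n) ℝ}
    (hU : Uᵀ * U = 1) (X : Matrix (Fin n) (Fin d) ℝ) (q : Matrix (Fin d) (Fin d) ℝ) :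
    ‖lowPass k U * X - spectralFeatures hkn U * resize k d * q‖ ^ 2
      = ∑ i : Fin k, ‖(WithLp.toLp 2 ((Uᵀ * X) (Fin.castLE hkn i)) : EuclideanSpace ℝ (Fin d))
        - WithLp.toLp 2 (q (Fin.castLE hkd i))‖ ^ 2 := by
  rw [lowPass_eq hkn, Matrix.mul_assoc, Matrix.mul_assoc, ← Matrix.mul_sub,
    frobenius_norm_mul_of_transpose_mul_self (spectralFeatures_transpose_mul_self hkn hU),
    frobenius_norm_sq_eq_sum_row]
  refine Finset.sum_congr rfl fun i _ => ?_
  rw [← WithLp.toLp_sub, ← resize_mul_apply hkd q i]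
  rfl

/-- The matrix with a given vector of entries. -/
def toMatrix (g : EuclideanSpace ℝ (Fin n × Fin d)) : Matrix (Fin n) (Fin d) ℝ :=
  Matrix.of fun i j => g (i, j)

theorem norm_toMatrix (g : EuclideanSpace ℝ (Fin n × Fin d)) : ‖toMatrix g‖ = ‖g‖ := by
  rw [← pow_left_inj₀ (norm_nonneg _) (norm_nonneg _) two_ne_zero, frobenius_norm_sq_eq_sum_row,
    EuclideanSpace.real_norm_sq_eq, Fintype.sum_prod_type]
  simp [EuclideanSpace.real_norm_sq_eq, toMatrix]

/-- The `i`-th row of `Uᵀ` times the matrix with the given entries. -/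
noncomputable def transposeMulRow (d : ℕ) (U : Matrix (Fin n) (Fin n) ℝ) (i : Fin n) :
    EuclideanSpace ℝ (Fin n × Fin d) →L[ℝ] EuclideanSpace ℝ (Fin d) :=
  LinearMap.toContinuousLinearMap
    { toFun := fun g => WithLp.toLp 2 fun c => ∑ l, U l i * g (l, c)
      map_add' := fun g h => by
        ext c
        simp [mul_add, Finset.sum_add_distrib]
      map_smul' := fun a g => by
        ext c
        simp [Finset.mul_sum, mul_left_comm] }

theorem transposeMulRow_apply (U : Matrix (Fin n) (Fin n) ℝ) (i : Fin n)
    (g : EuclideanSpace ℝ (Fin n × Fin d)) (c : Fin d) :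
    transposeMulRow d U i g c = ∑ l, U l i * g (l, c) := rfl

theorem toLp_transpose_mul_toMatrix (U : Matrix (Fin n) (Fin n) ℝ) (i : Fin n)
    (g : EuclideanSpace ℝ (Fin n × Fin d)) :
    (WithLp.toLp 2 ((Uᵀ * toMatrix g) i) : EuclideanSpace ℝ (Fin d)) = transposeMulRow d U i g := by
  ext c
  rw [transposeMulRow_apply]
  simp [Matrix.mul_apply, toMatrix]

theorem adjoint_transposeMulRow_apply (U : Matrix (Fin n) (Fin n) ℝ) (i : Fin n)
    (x : EuclideanSpace ℝ (Fin d)) (p : Fin n × Fin d) :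
    (transposeMulRow d U i).adjoint x p = U p.1 i * x p.2 := by
  have h := ContinuousLinearMap.adjoint_inner_right (transposeMulRow d U i)
    (EuclideanSpace.single p 1) x
  rw [EuclideanSpace.inner_single_left] at h
  simp only [map_one, one_mul] at h
  rw [h, PiLp.inner_apply]
  simp only [transposeMulRow_apply]
  rw [Finset.sum_eq_single p.2]
  · simp [Prod.ext_iff, mul_comm]
  · intro c _ hc
    simp [Prod.ext_iff, hc]
  · simp

theorem transposeMulRow_adjoint (U : Matrix (Fin n) (Fin n) ℝ) (hU : Uᵀ * U = 1) (i j : Fin n)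
    (x : EuclideanSpace ℝ (Fin d)) :
    transposeMulRow d U i ((transposeMulRow d U j).adjoint x) = if i = j then x else 0 := by
  ext c
  have := congrFun (congrFun hU i) j
  simp only [Matrix.mul_apply, Matrix.transpose_apply, Matrix.one_apply] at this
  rw [transposeMulRow_apply]
  simp_rw [adjoint_transposeMulRow_apply, ← mul_assoc]
  rw [← Finset.sum_mul, this]
  split_ifs <;> simp

end Matrices

/-! ### The distance to the rotated features: Lipschitz bound, mean, measurable near-minimizer. -/

section Procrustes

variable {n k d : ℕ}

/-- The matrices `Φ I q` with `q` orthogonal. -/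
def rotatedFeatures (hkn : k ≤ n) (d : ℕ) (U : Matrix (Fin n) (Fin n) ℝ) :
    Set (Matrix (Fin n) (Fin d) ℝ) :=
  Set.range fun q : Matrix.orthogonalGroup (Fin d) ℝ =>
    spectralFeatures hkn U * resize k d * (q : Matrix (Fin d) (Fin d) ℝ)

theorem rotatedFeatures_nonempty (hkn : k ≤ n) (d : ℕ) (U : Matrix (Fin n) (Fin n) ℝ) :
    (rotatedFeatures hkn d U).Nonempty := Set.range_nonempty _

/-- The distance of the compressive features of `M` to the rotated spectral features. -/
noncomputable def procrustesDist (hkn : k ≤ n) (U : Matrix (Fin n) (Fin n) ℝ)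
    (M : Matrix (Fin n) (Fin d) ℝ) : ℝ :=
  Metric.infDist (compressiveFeatures k U M) (rotatedFeatures hkn d U)

theorem lipschitzWith_procrustesDist (hkn : k ≤ n) {U : Matrix (Fin n) (Fin n) ℝ}
    (hU : Uᵀ * U = 1) (hU' : U * Uᵀ = 1) :
    LipschitzWith 1 (procrustesDist (d := d) hkn U) := by
  refine LipschitzWith.of_dist_le_mul fun X Y => ?_
  refine ((Metric.lipschitz_infDist_pt (rotatedFeatures hkn d U)).dist_le_mul _ _).trans ?_
  rw [dist_eq_norm, dist_eq_norm, compressiveFeatures, compressiveFeatures, ← Matrix.mul_sub]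
  gcongr
  exact norm_lowPass_mul_le hkn hU hU' (X - Y)

/-- The first `k` rows of `Uᵀ` times the matrix with the given entries, padded by zeros. -/
noncomputable def paddedRows (hkn : k ≤ n) (U : Matrix (Fin n) (Fin n) ℝ)
    (g : EuclideanSpace ℝ (Fin n × Fin d)) (j : Fin d) : EuclideanSpace ℝ (Fin d) :=
  if h : j.val < k then transposeMulRow d U ⟨j, h.trans_le hkn⟩ g else 0

theorem paddedRows_castLE (hkn : k ≤ n) (hkd : k ≤ d) (U : Matrix (Fin n) (Fin n) ℝ)
    (g : EuclideanSpace ℝ (Fin n × Fin d)) (i : Fin k) :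
    paddedRows hkn U g (Fin.castLE hkd i) = transposeMulRow d U (Fin.castLE hkn i) g := by
  simp [paddedRows, Fin.castLE]

theorem measurable_paddedRows (hkn : k ≤ n) (U : Matrix (Fin n) (Fin n) ℝ) :
    Measurable (paddedRows (d := d) hkn U) := by
  refine measurable_pi_lambda _ fun j => ?_
  unfold paddedRows
  split_ifs <;> fun_prop

/-- Orthogonality of the columns of `U` ensures that resampling row i leaves the earlier rows
unchanged. -/
theorem lt_integral_norm_gramSchmidt_paddedRows (hkn : k ≤ n) (hkd : k ≤ d)
    {U : Matrix (Fin n) (Fin n) ℝ} (hU : Uᵀ * U = 1) (i : Fin k) :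
    Integrable (fun g => ‖InnerProductSpace.gramSchmidt ℝ (paddedRows (d := d) hkn U g)
      (Fin.castLE hkd i)‖) (stdGaussian _) ∧
    ((d : ℝ) - i - 1 / 2) / √d < ∫ g, ‖InnerProductSpace.gramSchmidt ℝ
      (paddedRows (d := d) hkn U g) (Fin.castLE hkd i)‖ ∂stdGaussian _ := by
  have h := lt_integral_norm_gramSchmidt (d := d) (by simp) (paddedRows (d := d) hkn U)
    (measurable_paddedRows hkn U) (Fin.castLE hkd i) (transposeMulRow d U (Fin.castLE hkn i))
    (fun y => by rw [transposeMulRow_adjoint U hU, if_pos rfl])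
    (fun g => paddedRows_castLE hkn hkd U g i) (fun j hj g x => by
      have hj' : j.val < i.val := hj
      have hne : (⟨j, (hj'.trans i.2).trans_le hkn⟩ : Fin n) ≠ Fin.castLE hkn i :=
        fun h => hj'.ne (congrArg Fin.val h)
      rw [paddedRows, paddedRows, dif_pos (hj'.trans i.2), dif_pos (hj'.trans i.2), map_add,
        map_sub, transposeMulRow_adjoint U hU, transposeMulRow_adjoint U hU, if_neg hne]
      simp [hne])
  rwa [Fin.val_castLE, Nat.cast_sub (i.2.le.trans hkd)] at h

theorem procrustesDist_sq_le (hkn : k ≤ n) (hkd : k ≤ d) {U : Matrix (Fin n) (Fin n) ℝ}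
    (hU : Uᵀ * U = 1) (s : ℝ) (g : EuclideanSpace ℝ (Fin n × Fin d)) :
    procrustesDist hkn U (s • toMatrix g) ^ 2
      ≤ ∑ i : Fin k, (s ^ 2 * ‖transposeMulRow d U (Fin.castLE hkn i) g‖ ^ 2
        - 2 * s * ‖InnerProductSpace.gramSchmidt ℝ (paddedRows hkn U g) (Fin.castLE hkd i)‖
        + 1) := by
  set b := InnerProductSpace.gramSchmidtOrthonormalBasis (𝕜 := ℝ)
    (by simp : Module.finrank ℝ (EuclideanSpace ℝ (Fin d)) = Fintype.card (Fin d))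
    (paddedRows hkn U g) with hb
  -- The competitor in the infimum: its rows are the Gram-Schmidt basis of the padded Gaussian rows,
  -- so each cross term is a Gram-Schmidt norm.
  set q : Matrix (Fin d) (Fin d) ℝ := Matrix.of fun i c => b i c with hq
  have hqo : q ∈ Matrix.orthogonalGroup (Fin d) ℝ := by
    rw [Matrix.mem_orthogonalGroup_iff]
    ext i j
    have := orthonormal_iff_ite.1 b.orthonormal j i
    rw [PiLp.inner_apply] at this
    rw [Matrix.mul_apply, Matrix.one_apply]
    simp only [eq_comm (a := i)]
    rw [← this]
    simp [hq]
  have h1 : procrustesDist hkn U (s • toMatrix g)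
      ≤ ‖lowPass k U * (s • toMatrix g) - spectralFeatures hkn U * resize k d * q‖ := by
    rw [← dist_eq_norm]
    exact Metric.infDist_le_dist_of_mem ⟨⟨q, hqo⟩, rfl⟩
  have h2 := pow_le_pow_left₀ Metric.infDist_nonneg h1 2
  rw [norm_lowPass_mul_sub_sq hkn hkd hU] at h2
  refine h2.trans (le_of_eq (Finset.sum_congr rfl fun i _ => ?_))
  have h3 : (WithLp.toLp 2 ((Uᵀ * (s • toMatrix g)) (Fin.castLE hkn i))
      : EuclideanSpace ℝ (Fin d)) = s • transposeMulRow d U (Fin.castLE hkn i) g := by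
    rw [← toLp_transpose_mul_toMatrix, Matrix.mul_smul]
    rfl
  have h4 : (WithLp.toLp 2 (q (Fin.castLE hkd i)) : EuclideanSpace ℝ (Fin d))
      = b (Fin.castLE hkd i) := rfl
  rw [h3, h4, norm_sub_sq_real, b.norm_eq_one, inner_smul_left, ← paddedRows_castLE hkn hkd,
    inner_gramSchmidtOrthonormalBasis_self, norm_smul, mul_pow]
  simp
  ring

theorem integral_norm_transposeMulRow_sq {U : Matrix (Fin n) (Fin n) ℝ} (hU : Uᵀ * U = 1)
    (i : Fin n) :
    Integrable (fun g => ‖transposeMulRow d U i g‖ ^ 2) (stdGaussian _) ∧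
    ∫ g, ‖transposeMulRow d U i g‖ ^ 2 ∂stdGaussian _ = d := by
  have h := stdGaussian_map_of_adjoint (transposeMulRow d U i) fun t => by
    rw [← pow_left_inj₀ (norm_nonneg _) (norm_nonneg _) two_ne_zero, ← real_inner_self_eq_norm_sq,
      ContinuousLinearMap.adjoint_inner_left, transposeMulRow_adjoint U hU, if_pos rfl,
      real_inner_self_eq_norm_sq]
  have hm : AEMeasurable (transposeMulRow d U i) (stdGaussian _) := by fun_prop
  constructor
  · have h2 := integrable_norm_pow_stdGaussian (E := EuclideanSpace ℝ (Fin d)) 2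
    rw [← h] at h2
    exact (integrable_map_measure (by fun_prop) hm).1 h2
  · have h2 := integral_norm_sq_stdGaussian (E := EuclideanSpace ℝ (Fin d))
    rw [← h, integral_map hm (by fun_prop)] at h2
    simpa using h2

theorem sum_two_mul_add_one (k : ℕ) : ∑ i : Fin k, (2 * (i : ℝ) + 1) = (k : ℝ) ^ 2 := by
  rw [Fin.sum_univ_eq_sum_range (fun i => 2 * (i : ℝ) + 1)]
  induction k with
  | zero => simp
  | succ k ih =>
    rw [Finset.sum_range_succ, ih]
    push_cast
    ring

theorem lipschitzWith_procrustesDist_smul_toMatrix (hkn : k ≤ n) {U : Matrix (Fin n) (Fin n) ℝ}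
    (hU : Uᵀ * U = 1) (hU' : U * Uᵀ = 1) (s : ℝ≥0) :
    LipschitzWith s fun g : EuclideanSpace ℝ (Fin n × Fin d) =>
      procrustesDist hkn U ((s : ℝ) • toMatrix g) := by
  refine LipschitzWith.of_dist_le_mul fun g h => ?_
  refine ((lipschitzWith_procrustesDist hkn hU hU').dist_le_mul _ _).trans (le_of_eq ?_)
  have : toMatrix g - toMatrix h = toMatrix (g - h) := rfl
  have h2 : (s : ℝ) • toMatrix (g - h) = toMatrix ((s : ℝ) • (g - h)) := rfl
  rw [dist_eq_norm, dist_eq_norm, ← smul_sub, this, h2, norm_toMatrix, norm_smul]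
  simp

theorem integral_procrustesDist_lt (hk : 0 < k) (hkn : k ≤ n) (hkd : k ≤ d)
    {U : Matrix (Fin n) (Fin n) ℝ} (hU : Uᵀ * U = 1) (hU' : U * Uᵀ = 1) {s : ℝ≥0}
    (hs : (s : ℝ) = (√d)⁻¹) :
    ∫ g, procrustesDist (d := d) hkn U ((s : ℝ) • toMatrix g) ∂stdGaussian _ < k / √d := by
  set γ := stdGaussian (EuclideanSpace ℝ (Fin n × Fin d))
  set f : EuclideanSpace ℝ (Fin n × Fin d) → ℝ :=
    fun g => procrustesDist hkn U ((s : ℝ) • toMatrix g) with hf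
  have hd : (0 : ℝ) < d := by exact_mod_cast (by omega : 0 < d)
  have hd' : 0 < √(d : ℝ) := Real.sqrt_pos.2 hd
  have hsd : (s : ℝ) ^ 2 * d = 1 := by
    rw [hs, inv_pow, Real.sq_sqrt hd.le, inv_mul_cancel₀ hd.ne']
  have hL := lipschitzWith_procrustesDist_smul_toMatrix (d := d) hkn hU hU' s
  have hfI : Integrable f γ := integrable_of_lipschitzWith_stdGaussian hL
  set T : Fin k → EuclideanSpace ℝ (Fin n × Fin d) → ℝ := fun i g =>
    s ^ 2 * ‖transposeMulRow d U (Fin.castLE hkn i) g‖ ^ 2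
      - 2 * s * ‖InnerProductSpace.gramSchmidt ℝ (paddedRows hkn U g) (Fin.castLE hkd i)‖ + 1
    with hT
  have hTI : ∀ i, Integrable (T i) γ := fun i =>
    (((integral_norm_transposeMulRow_sq hU _).1.const_mul _).sub
      ((lt_integral_norm_gramSchmidt_paddedRows hkn hkd hU i).1.const_mul _)).add
      (integrable_const _)
  have hTle : ∀ i, ∫ g, T i g ∂γ < (2 * (i : ℝ) + 1) / d := fun i => by
    obtain ⟨i1, e1⟩ := integral_norm_transposeMulRow_sq (d := d) hU (Fin.castLE hkn i)
    obtain ⟨i2, e2⟩ := lt_integral_norm_gramSchmidt_paddedRows hkn hkd hU i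
    have i12 : Integrable (fun g => (s : ℝ) ^ 2 * ‖transposeMulRow d U (Fin.castLE hkn i) g‖ ^ 2
      - 2 * s * ‖InnerProductSpace.gramSchmidt ℝ (paddedRows hkn U g) (Fin.castLE hkd i)‖) γ :=
      (i1.const_mul _).sub (i2.const_mul _)
    rw [integral_add i12 (integrable_const _), integral_sub (i1.const_mul _) (i2.const_mul _),
      integral_const_mul, integral_const_mul, e1, hsd]
    have hs0 : (0 : ℝ) < 2 * s := by
      rw [hs]
      positivity
    have h3 := mul_lt_mul_of_pos_left e2 hs0
    have h4 : 2 * (s : ℝ) * (((d : ℝ) - i - 1 / 2) / √d) = 2 - (2 * (i : ℝ) + 1) / d := by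
      have : 2 * (s : ℝ) * (((d : ℝ) - i - 1 / 2) / √d) = 2 * (((d : ℝ) - i - 1 / 2) / (√d) ^ 2) := by
        rw [hs]
        field_simp
      rw [this, Real.sq_sqrt hd.le]
      field_simp
      ring
    rw [h4] at h3
    simp only [integral_const, probReal_univ, one_smul]
    linarith
  have hsqI : Integrable (fun g => f g ^ 2) γ := by
    refine (integrable_finsetSum Finset.univ fun i _ => hTI i).mono'
      (hfI.aestronglyMeasurable.pow 2) (ae_of_all _ fun g => ?_)
    rw [Real.norm_of_nonneg (sq_nonneg _)]
    exact procrustesDist_sq_le hkn hkd hU s g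
  have hsq : ∫ g, f g ^ 2 ∂γ < (k : ℝ) ^ 2 / d := by
    calc ∫ g, f g ^ 2 ∂γ ≤ ∫ g, ∑ i, T i g ∂γ :=
          integral_mono hsqI (integrable_finsetSum Finset.univ fun i _ => hTI i)
            fun g => procrustesDist_sq_le hkn hkd hU s g
      _ = ∑ i, ∫ g, T i g ∂γ := integral_finsetSum _ fun i _ => hTI i
      _ < ∑ i : Fin k, (2 * (i : ℝ) + 1) / d :=
          Finset.sum_lt_sum_of_nonempty ⟨⟨0, hk⟩, Finset.mem_univ _⟩ fun i _ => hTle i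
      _ = (k : ℝ) ^ 2 / d := by rw [← Finset.sum_div, sum_two_mul_add_one]
  -- Jensen's inequality, as nonnegativity of the variance.
  have hvar : (∫ g, f g ∂γ) ^ 2 ≤ ∫ g, f g ^ 2 ∂γ := by
    set e := ∫ g, f g ∂γ with he
    have h0 : 0 ≤ ∫ g, (f g ^ 2 - 2 * e * f g + e ^ 2) ∂γ := integral_nonneg fun g => by
      have : f g ^ 2 - 2 * e * f g + e ^ 2 = (f g - e) ^ 2 := by ring
      simp only [this]
      positivity
    have hi : Integrable (fun g => f g ^ 2 - 2 * e * f g) γ := hsqI.sub (hfI.const_mul _)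
    rw [integral_add hi (integrable_const _), integral_sub hsqI (hfI.const_mul _),
      integral_const_mul, ← he] at h0
    simp only [integral_const, probReal_univ, one_smul] at h0
    linarith
  refine lt_of_pow_lt_pow_left₀ 2 (by positivity) ?_
  rw [div_pow, Real.sq_sqrt hd.le]
  exact hvar.trans_lt hsq

theorem continuous_procrustesDist_of (hkn : k ≤ n) {U : Matrix (Fin n) (Fin n) ℝ}
    (hU : Uᵀ * U = 1) (hU' : U * Uᵀ = 1) :
    Continuous fun x : Fin n → Fin d → ℝ => procrustesDist hkn U (Matrix.of x) :=
  (lipschitzWith_procrustesDist hkn hU hU').continuous.comp continuous_id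

/-- A measurable choice of nearly optimal rotations. -/
theorem exists_measurable_procrustes (hkn : k ≤ n) {U : Matrix (Fin n) (Fin n) ℝ}
    (hU : Uᵀ * U = 1) (hU' : U * Uᵀ = 1) {δ : ℝ} (hδ : 0 < δ) :
    ∃ Q : Matrix (Fin n) (Fin d) ℝ → Matrix (Fin d) (Fin d) ℝ,
      (∀ a b, Measurable fun x : Fin n → Fin d → ℝ => Q (Matrix.of x) a b) ∧
      (∀ M, Q M ∈ Matrix.orthogonalGroup (Fin d) ℝ) ∧
      ∀ M, ‖compressiveFeatures k U M - spectralFeatures hkn U * resize k d * Q M‖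
        < procrustesDist hkn U M + δ := by
  classical
  have : Nonempty (Matrix.orthogonalGroup (Fin d) ℝ) := ⟨1⟩
  have : SecondCountableTopology (Matrix (Fin d) (Fin d) ℝ) :=
    inferInstanceAs (SecondCountableTopology (Fin d → Fin d → ℝ))
  have : SecondCountableTopology (Matrix.orthogonalGroup (Fin d) ℝ) :=
    TopologicalSpace.Subtype.secondCountableTopology _
  -- Near-optimality is an open condition on the rotation, so some member of a countable dense
  -- sequence satisfies it; the first such index is selected.
  set q : ℕ → Matrix.orthogonalGroup (Fin d) ℝ := TopologicalSpace.denseSeq _ with hq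
  set D : Matrix (Fin n) (Fin d) ℝ → ℕ → Prop := fun M j =>
    ‖compressiveFeatures k U M - spectralFeatures hkn U * resize k d
      * (q j : Matrix (Fin d) (Fin d) ℝ)‖ < procrustesDist hkn U M + δ with hD
  have hex : ∀ M, ∃ j, D M j := fun M => by
    obtain ⟨_, ⟨q0, rfl⟩, hq0⟩ := (Metric.infDist_lt_iff
      (rotatedFeatures_nonempty hkn d U)).1 (lt_add_of_pos_right (procrustesDist hkn U M) hδ)
    rw [dist_eq_norm] at hq0
    have hc : Continuous fun p : Matrix.orthogonalGroup (Fin d) ℝ =>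
        ‖compressiveFeatures k U M - spectralFeatures hkn U * resize k d
          * (p : Matrix (Fin d) (Fin d) ℝ)‖ := by
      refine continuous_norm.comp (continuous_const.sub ?_)
      exact continuous_const.matrix_mul continuous_subtype_val
    exact (TopologicalSpace.denseRange_denseSeq _).exists_mem_open
      (isOpen_Iio.preimage hc) ⟨q0, hq0⟩
  refine ⟨fun M => q (Nat.find (hex M)), fun a b => ?_, fun M => (q _).2,
    fun M => Nat.find_spec (hex M)⟩
  -- For a fixed index the condition is also open in `M`, both sides being continuous.
  have hmeas : Measurable fun x : Fin n → Fin d → ℝ => Nat.find (hex (Matrix.of x)) := by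
    refine measurable_find (fun x => hex (Matrix.of x)) fun j => ?_
    refine IsOpen.measurableSet (isOpen_lt ?_ ?_)
    · refine continuous_norm.comp (Continuous.sub ?_ continuous_const)
      exact continuous_const.matrix_mul continuous_id
    · exact (continuous_procrustesDist_of hkn hU hU').add continuous_const
  exact (measurable_from_nat (f := fun j => (q j : Matrix (Fin d) (Fin d) ℝ) a b)).comp hmeas

theorem IsGaussianMatrix.map_eq_stdGaussian {Ω : Type*} [MeasurableSpace Ω] {P : Measure Ω}
    [IsProbabilityMeasure P] {R : Ω → Matrix (Fin n) (Fin d) ℝ} (hR : IsGaussianMatrix R P)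
    (hd : 0 < d) :
    AEMeasurable (fun ω => (WithLp.toLp 2 fun p => √d * R ω p.1 p.2 :
      EuclideanSpace ℝ (Fin n × Fin d))) P ∧
    P.map (fun ω => (WithLp.toLp 2 fun p => √d * R ω p.1 p.2 :
      EuclideanSpace ℝ (Fin n × Fin d))) = stdGaussian _ := by
  have hd0 : (0 : ℝ) < d := by exact_mod_cast hd
  have hm : ∀ p : Fin n × Fin d, AEMeasurable (fun ω => √d * R ω p.1 p.2) P := fun p =>
    (hR.law p.1 p.2).aemeasurable.const_mul _
  have hlaw : ∀ p : Fin n × Fin d, P.map (fun ω => √d * R ω p.1 p.2) = gaussianReal 0 1 := by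
    intro p
    have h1 : (fun ω => √d * R ω p.1 p.2) = (fun y => √d * y) ∘ fun ω => R ω p.1 p.2 := rfl
    rw [h1, ← AEMeasurable.map_map_of_aemeasurable (by fun_prop) (hR.law p.1 p.2).aemeasurable,
      (hR.law p.1 p.2).map_eq, gaussianReal_map_const_mul, mul_zero]
    congr 1
    ext
    simp [Real.sq_sqrt hd0.le, hd0.ne']
  have hind : iIndepFun (fun (p : Fin n × Fin d) ω => √d * R ω p.1 p.2) P :=
    hR.indep.comp (fun _ y => √d * y) fun _ => by fun_prop
  have hpi := (iIndepFun_iff_map_fun_eq_pi_map hm).1 hind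
  simp_rw [hlaw] at hpi
  have hmp : AEMeasurable (fun ω (p : Fin n × Fin d) => √d * R ω p.1 p.2) P :=
    aemeasurable_pi_lambda _ hm
  have hto : Measurable (WithLp.toLp 2 : (Fin n × Fin d → ℝ) → _) := WithLp.measurable_toLp 2 _
  refine ⟨hto.comp_aemeasurable hmp, ?_⟩
  rw [← map_pi_eq_stdGaussian, ← hpi, AEMeasurable.map_map_of_aemeasurable hto.aemeasurable hmp]
  rfl

end Procrustes

end CSC

/-! ### Conclusion: concentration of the distance around its mean. -/

theorem mainTheorem3 {n k d : ℕ} (hk : 0 < k) (hkn : k ≤ n) (hkd : k ≤ d)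
    (G : CSC.WeightedGraph n) (L U : Matrix (Fin n) (Fin n) ℝ) (lam : Fin n → ℝ)
    (hL : G.IsLaplacian L) (hU : CSC.IsEigendecomposition L U lam)
    {Ω : Type*} [MeasurableSpace Ω] (P : Measure Ω) [IsProbabilityMeasure P]
    (R : Ω → Matrix (Fin n) (Fin d) ℝ) (hR : CSC.IsGaussianMatrix R P) :
    ∃ Q : Matrix (Fin n) (Fin d) ℝ → Matrix (Fin d) (Fin d) ℝ,
      (∀ a b, Measurable fun x : Fin n → Fin d → ℝ => Q (Matrix.of x) a b) ∧
      (∀ M, Q M ∈ Matrix.orthogonalGroup (Fin d) ℝ) ∧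
      ∀ t : ℝ, 0 ≤ t →
        1 - Real.exp (-t ^ 2 / 2) ≤
          P.real {ω | ‖CSC.compressiveFeatures k U (R ω)
              - CSC.spectralFeatures hkn U * CSC.resize k d * Q (R ω)‖
            ≤ √((k : ℝ) / (d : ℝ)) * (√(k : ℝ) + t)} := by
  have hU1 : Uᵀ * U = 1 := (Matrix.mem_orthogonalGroup_iff' (Fin n) ℝ).1 hU.orthogonal
  have hU2 : U * Uᵀ = 1 := (Matrix.mem_orthogonalGroup_iff (Fin n) ℝ).1 hU.orthogonal
  have hd : 0 < d := hk.trans_le hkd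
  have hd0 : (0 : ℝ) < d := by exact_mod_cast hd
  have hd' : 0 < √(d : ℝ) := Real.sqrt_pos.2 hd0
  obtain ⟨s, hs⟩ : ∃ s : ℝ≥0, (s : ℝ) = (√d)⁻¹ := ⟨⟨(√d)⁻¹, by positivity⟩, rfl⟩
  have hs0 : 0 < s := by
    rw [← NNReal.coe_pos, hs]
    positivity
  set f : EuclideanSpace ℝ (Fin n × Fin d) → ℝ :=
    fun g => CSC.procrustesDist hkn U ((s : ℝ) • CSC.toMatrix g) with hf
  have hlt : ∫ g, f g ∂stdGaussian _ < k / √d :=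
    CSC.integral_procrustesDist_lt hk hkn hkd hU1 hU2 hs
  -- The slack is δ = k/√d - E f, fixed before `t` is introduced, so `Q` does not depend on `t`.
  obtain ⟨Q, hQm, hQo, hQ⟩ := CSC.exists_measurable_procrustes (d := d) hkn hU1 hU2
    (sub_pos.2 hlt)
  refine ⟨Q, hQm, hQo, fun t ht => ?_⟩
  have hfL : LipschitzWith s f :=
    CSC.lipschitzWith_procrustesDist_smul_toMatrix hkn hU1 hU2 s
  obtain ⟨hXm, hX⟩ := hR.map_eq_stdGaussian hd
  set X : Ω → EuclideanSpace ℝ (Fin n × Fin d) :=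
    fun ω => WithLp.toLp 2 fun p => √d * R ω p.1 p.2 with hXdef
  have hRX : ∀ ω, (s : ℝ) • CSC.toMatrix (X ω) = R ω := fun ω => by
    ext i j
    simp only [Matrix.smul_apply, CSC.toMatrix, Matrix.of_apply, hXdef, smul_eq_mul, hs]
    rw [inv_mul_cancel_left₀ hd'.ne']
  set A : Set (EuclideanSpace ℝ (Fin n × Fin d)) :=
    {g | ∫ y, f y ∂stdGaussian _ + s * (√k * t) ≤ f g} with hA
  have hAm : MeasurableSet A := measurableSet_le measurable_const hfL.continuous.measurable
  have hconc : (stdGaussian _).real A ≤ Real.exp (-t ^ 2 / 2) := by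
    refine (CSC.stdGaussian_real_ge_le_of_lipschitzWith hs0 hfL (by positivity)).trans ?_
    -- Deviation √k t gives the stronger bound exp(-kt²/2); k ≥ 1 weakens it to the stated one.
    refine Real.exp_le_exp.2 ?_
    rw [mul_pow, Real.sq_sqrt (Nat.cast_nonneg k)]
    have : (1 : ℝ) ≤ k := by exact_mod_cast hk
    nlinarith [sq_nonneg t]
  have hPA : P.real (X ⁻¹' A) ≤ Real.exp (-t ^ 2 / 2) := by
    rwa [← map_measureReal_apply_of_aemeasurable hXm hAm, hX]
  have hcompl : 1 - P.real (X ⁻¹' A) ≤ P.real (X ⁻¹' A)ᶜ := by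
    have := measureReal_union_le (μ := P) (X ⁻¹' A) (X ⁻¹' A)ᶜ
    rw [Set.union_compl_self, probReal_univ] at this
    linarith
  refine (by linarith : 1 - Real.exp (-t ^ 2 / 2) ≤ P.real (X ⁻¹' A)ᶜ).trans
    (measureReal_mono fun ω hω => ?_)
  have hω' : f (X ω) < ∫ y, f y ∂stdGaussian _ + s * (√k * t) := not_le.1 hω
  have hfX : f (X ω) = CSC.procrustesDist hkn U (R ω) := by rw [hf, ← hRX ω]
  have h1 := hQ (R ω)
  -- Off the bad event the error is below f + δ < E f + s√k t + (k/√d - E f), where the mean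
  -- cancels.
  have h2 : √((k : ℝ) / d) * (√k + t) = k / √d + s * (√k * t) := by
    rw [Real.sqrt_div (Nat.cast_nonneg k), hs, mul_add, div_mul_eq_mul_div,
      Real.mul_self_sqrt (Nat.cast_nonneg k)]
    ring
  rw [Set.mem_ofPred_eq]
  rw [h2]
  linarith
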